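/- \textbf{Setting.} Let $\Gamma\subset\mathbb R^2$ be a smooth simple open curve, with a $C^\infty$ injective parametrization $r:[-1,1]\to\Gamma$ of constant speed $|r'|=|\Gamma|/2$, where $|\Gamma|>0$ is the length of $\Gamma$. Let $T_n,U_n$ be the Chebyshev polynomials of the first and second kind ($U_{-1}=0$). For $s\in\mathbb R$, $T^s$ is the space of formal series $u=\sum_{n\ge0}\hat u_nT_n$ with $$\|u\|_{T^s}^2=|\hat u_0|^2+\tfrac12\sum_{n\ge1}(1+n^2)^s|\hat u_n|^2<\infty ,$$ $T^\infty=\bigcap_sT^s$ (identified with $C^\infty([-1,1])$) and $T^{-\infty}=\bigcup_sT^s$. The space $T^{-\infty}$ carries the weak-$*$ topology given by the pairings $\langle u,\varphi\rangle=\hat u_0\hat\varphi_0+\frac12\sum_{n\ge1}\hat u_n\hat\varphi_n$, $\varphi\in T^\infty$. With $R_\Gamma u=u\circ r$, the spaces $T^s(\Gamma)$ and $T^{\pm\infty}(\Gamma)$ are defined in the same way from the functions $R_\Gamma^{-1}T_n$, so that $R_\Gamma:\sum\hat u_nR_\Gamma^{-1}T_n\mapsto\sum\hat u_nT_n$ is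 an isometry of $T^s(\Gamma)$ onto $T^s$. Let $\mathcal C$ be the map $\sum\hat u_nT_n\mapsto\sum\hat u_n\cos(n\theta)$ from $T^{-\infty}$ to the even $2\pi$-periodic distributions. For $\alpha\in\mathbb R$, $\Sigma^\alpha$ is the set of functions $\sigma(\theta,n)$ on $\mathbb R/2\pi\mathbb Z\times\mathbb Z$ that extend to some $\sigma\in C^\infty(\mathbb R/2\pi\mathbb Z\times\mathbb R)$ with $|\partial_\theta^j\partial_\xi^k\sigma(\theta,\xi)|\le C_{jk}(1+|\xi|)^{\alpha-k}$ for all $j,k\ge0$. A periodic pseudo-differential operator (PPDO) of order $\alpha$ is an operator $Op(\sigma)u(\theta)=\sum_{n\in\mathbb Z}\sigma(\theta,n)\,\mathcal Fu(n)\,e^{in\theta}$ with $\sigma\in\Sigma^\alpha$ and $\mathcal Fu(n)$ the Fourier coefficients of $u$; its symbol is $\sigma_{\tilde A}(\theta,n)=e^{-in\theta}(\tilde Ae_n)(\theta)$ with $e_n(\theta)=e^{in\theta}$. The symbol $\sigma\in\Sigma^\alpha$ (and the operator $Op(\sigma)$) is elliptic of order $\alpha$ if there are $C>0$ and $M$ with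 $|\sigma(\theta,n)|\ge C(1+|n|)^\alpha$ for all $\theta$ and all $|n|\ge M$. For functions $a_1,a_2$ on $[-1,1]\times\mathbb N$ that are $C^\infty$ in the first variable, let $$\tilde\sigma(a_1,a_2)(\theta,n)=a_1(\cos\theta,|n|)+i\sin\theta\,\mathrm{sign}(n)\,a_2(\cos\theta,|n|).$$ The pair $(a_1,a_2)$ is a \emph{pair of symbols of order $\alpha$} of a continuous linear operator $A$ on $T^{-\infty}$ if $\tilde\sigma(a_1,a_2)\in\Sigma^\alpha$ and, for all $n\in\mathbb N$, $$AT_n=a_1(x,n)T_n-(1-x^2)\,a_2(x,n)\,U_{n-1}.$$ A pair of symbols of order $\alpha$ of a continuous linear operator $A$ on $T^{-\infty}(\Gamma)$ is one of $R_\Gamma AR_\Gamma^{-1}$; $Op(S^\alpha_T(\Gamma))$ is the set of those $A$ that have one, and $A$ is elliptic (of order $\alpha$) if it has one for which $\tilde\sigma(a_1,a_2)$ is elliptic of order $\alpha$. For an operator $\tilde A$ on smooth periodic functions with symbol $\sigma_{\tilde A}$, put $\tilde\sigma(\theta,n)=\frac12\big(\sigma_{\tilde A}(\theta,n)+\sigma_{\tilde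 A}(-\theta,-n)\big)$ and $$a_1(\tilde A)(x,n)=\frac{\tilde\sigma(\arccos x,n)+\tilde\sigma(\arccos x,-n)}2,\qquad a_2(\tilde A)(x,n)=\frac{\tilde\sigma(\arccos x,n)-\tilde\sigma(\arccos x,-n)}{2i\sqrt{1-x^2}},$$ the latter extended by continuity to $x=\pm1$. \textbf{Statement.} For all $\alpha,\beta\in\mathbb R$: \begin{itemize} \item[(i)] If $A\in Op(S^\alpha_T(\Gamma))$, then $A$ maps $T^s(\Gamma)$ continuously into $T^{s-\alpha}(\Gamma)$ for every $s\in\mathbb R$. \item[(ii)] If $A\in Op(S^\alpha_T(\Gamma))$ and $B\in Op(S^\beta_T(\Gamma))$, then $AB\in Op(S^{\alpha+\beta}_T(\Gamma))$. \item[(iii)] If $A$ and $B$ admit the pairs of symbols $(a_1,a_2)$ of order $\alpha$ and $(b_1,b_2)$ of order $\beta$, then $AB$ admits the pair of symbols $(a_1(\tilde C),a_2(\tilde C))$ of order $\alpha+\beta$, where $\tilde C=Op(\tilde\sigma(a_1,a_2))\,Op(\tilde\sigma(b_1,b_2))$. \item[(iv)] If $A\in Op(S^\alpha_T(\Gamma))$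 and $B\in Op(S^\beta_T(\Gamma))$, then $AB-BA\in Op(S^{\alpha+\beta-1}_T(\Gamma))$. \item[(v)] An operator $A\in Op(S^\alpha_T(\Gamma))$ is elliptic if and only if there is an elliptic PPDO $\tilde A$ of order $\alpha$ with $\mathcal C R_\Gamma AR_\Gamma^{-1}=\tilde A\,\mathcal C$ on $T^\infty$. \end{itemize} -/

import Mathlib

open scoped ContDiff

noncomputable section

namespace ArcPDO

/-! ### Formal Chebyshev series and the scale `T^s` -/

/-- Coefficient sequences `c` with `∑ (1 + n²)^s |c n|² < ∞`. -/
def coeffSpace (s : ℝ) : Submodule ℂ (ℕ → ℂ) where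
  carrier := {c | Summable fun n : ℕ => (1 + (n : ℝ) ^ 2) ^ s * ‖c n‖ ^ 2}
  zero_mem' := by simp
  add_mem' := by
    intro a b ha hb
    refine Summable.of_nonneg_of_le (fun n => by positivity) (fun n => ?_)
      ((ha.add hb).mul_left 2)
    have hw : 0 ≤ (1 + (n : ℝ) ^ 2) ^ s := by positivity
    have h1 : ‖a n + b n‖ ^ 2 ≤ 2 * (‖a n‖ ^ 2 + ‖b n‖ ^ 2) := by
      have h2 := norm_add_le (a n) (b n)
      nlinarith [sq_nonneg (‖a n‖ - ‖b n‖), norm_nonneg (a n + b n)]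
    have h3 := mul_le_mul_of_nonneg_left h1 hw
    calc _ ≤ _ := h3
      _ = _ := by ring
  smul_mem' := by
    intro k a ha
    refine (Summable.mul_left (‖k‖ ^ 2) ha).congr (fun n => ?_)
    simp only [Pi.smul_apply, smul_eq_mul, norm_mul]
    ring

lemma coeffSpace_anti {s t : ℝ} (h : s ≤ t) : coeffSpace t ≤ coeffSpace s := by
  intro c hc
  refine Summable.of_nonneg_of_le (fun n => by positivity) (fun n => ?_) hc
  exact mul_le_mul_of_nonneg_right
    (Real.rpow_le_rpow_of_exponent_le (by nlinarith [sq_nonneg (n : ℝ)]) h) (by positivity)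

/-- The union of all the `coeffSpace s`, `s ∈ ℝ`. -/
def coeffNegInf : Submodule ℂ (ℕ → ℂ) where
  carrier := {c | ∃ s : ℝ, c ∈ coeffSpace s}
  zero_mem' := ⟨0, (coeffSpace 0).zero_mem⟩
  add_mem' := by
    rintro a b ⟨s, ha⟩ ⟨t, hb⟩
    exact ⟨min s t, (coeffSpace _).add_mem (coeffSpace_anti (min_le_left s t) ha)
      (coeffSpace_anti (min_le_right s t) hb)⟩
  smul_mem' := by
    rintro k a ⟨s, ha⟩
    exact ⟨s, (coeffSpace s).smul_mem k ha⟩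

/-- Coefficient sequences lying in every `coeffSpace s`. -/
def coeffInf : Submodule ℂ (ℕ → ℂ) := ⨅ s : ℝ, coeffSpace s

/-- Formal series `u = ∑ û_n e_n` in a family `e` of functions on `X`, with coefficients in
`⋃ s, coeffSpace s`. For `e = chebT` (resp. `e = Γ.chebT`) this is `T^{-∞}` (resp. `T^{-∞}(Γ)`). -/
structure FormalSeries {X : Type} (e : ℕ → X → ℂ) : Type where
  /-- the coefficients `û_n` -/
  coeff : ℕ → ℂ
  mem : coeff ∈ coeffNegInf

namespace FormalSeries

variable {X Y : Type} {e : ℕ → X → ℂ} {f : ℕ → Y → ℂ}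

/-- A series is the same as its sequence of coefficients. -/
def toCoeff (e : ℕ → X → ℂ) : FormalSeries e ≃ coeffNegInf where
  toFun u := ⟨u.coeff, u.mem⟩
  invFun c := ⟨c.1, c.2⟩
  left_inv _ := rfl
  right_inv _ := rfl

instance : AddCommGroup (FormalSeries e) := (toCoeff e).addCommGroup

instance : Module ℂ (FormalSeries e) := (toCoeff e).module ℂ

@[simp] lemma coeff_add (u v : FormalSeries e) : (u + v).coeff = u.coeff + v.coeff := rfl

@[simp] lemma coeff_smul (k : ℂ) (u : FormalSeries e) : (k • u).coeff = k • u.coeff := rfl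

/-- The duality product `⟨u, φ⟩_{1/ω} = û_0 φ̂_0 + ½ ∑_{n ≥ 1} û_n φ̂_n`, for `φ ∈ T^∞`
(given by its coefficients). -/
def pairing (u : FormalSeries e) (φ : coeffInf) : ℂ :=
  u.coeff 0 * φ.1 0 + (1 / 2) * ∑' n : ℕ, u.coeff (n + 1) * φ.1 (n + 1)

lemma summable_pairing (u : FormalSeries e) (φ : coeffInf) :
    Summable fun n : ℕ => u.coeff (n + 1) * φ.1 (n + 1) := by
  obtain ⟨s, hs⟩ := u.mem
  have hφ : φ.1 ∈ coeffSpace (-s) := (Submodule.mem_iInf _).1 φ.2 (-s)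
  have key : Summable fun n : ℕ => u.coeff n * φ.1 n := by
    refine Summable.of_norm_bounded (hs.add hφ) (fun n => ?_)
    set w : ℝ := 1 + (n : ℝ) ^ 2
    have hw : 0 < w := by positivity
    have e1 : w ^ s * ‖u.coeff n‖ ^ 2 = (w ^ (s / 2) * ‖u.coeff n‖) ^ 2 := by
      rw [mul_pow, ← Real.rpow_natCast (w ^ (s / 2)) 2, ← Real.rpow_mul hw.le]; norm_num
    have e2 : w ^ (-s) * ‖φ.1 n‖ ^ 2 = (w ^ (-s / 2) * ‖φ.1 n‖) ^ 2 := by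
      rw [mul_pow, ← Real.rpow_natCast (w ^ (-s / 2)) 2, ← Real.rpow_mul hw.le]; norm_num
    have e3 : ‖u.coeff n * φ.1 n‖ = (w ^ (s / 2) * ‖u.coeff n‖) * (w ^ (-s / 2) * ‖φ.1 n‖) := by
      have : w ^ (s / 2) * w ^ (-s / 2) = 1 := by
        rw [← Real.rpow_add hw]; ring_nf; simp
      rw [norm_mul]
      linear_combination (-(‖u.coeff n‖ * ‖φ.1 n‖)) * this
    rw [e1, e2, e3]
    nlinarith [sq_nonneg ((w ^ (s / 2) * ‖u.coeff n‖) - (w ^ (-s / 2) * ‖φ.1 n‖)),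
      sq_nonneg ((w ^ (s / 2) * ‖u.coeff n‖) + (w ^ (-s / 2) * ‖φ.1 n‖))]
  exact (summable_nat_add_iff 1).2 key

/-- The linear map sending `u` to the linear form `⟨u, ·⟩_{1/ω}` on `T^∞`. -/
def pairingMap (e : ℕ → X → ℂ) : FormalSeries e →ₗ[ℂ] (coeffInf → ℂ) where
  toFun u φ := pairing u φ
  map_add' u v := by
    funext φ
    simp only [pairing, coeff_add, Pi.add_apply, add_mul]
    rw [(summable_pairing u φ).tsum_add (summable_pairing v φ)]
    ring
  map_smul' k u := by
    funext φ
    simp only [pairing, coeff_smul, Pi.smul_apply, smul_eq_mul, mul_assoc, tsum_mul_left,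
      RingHom.id_apply]
    ring

/-- The weak-* topology of `T^{-∞}` as the dual of `T^∞`: the coarsest topology for which all the
maps `u ↦ ⟨u, φ⟩_{1/ω}`, `φ ∈ T^∞`, are continuous. -/
instance : TopologicalSpace (FormalSeries e) :=
  TopologicalSpace.induced (pairingMap e) inferInstance

instance : IsTopologicalAddGroup (FormalSeries e) :=
  topologicalAddGroup_induced (pairingMap e)

/-- `T^s`, as a subspace of `T^{-∞}`. -/
def T (e : ℕ → X → ℂ) (s : ℝ) : Set (FormalSeries e) := {u | u.coeff ∈ coeffSpace s}

/-- `T^∞`, the intersection of all the `T^s`. -/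
def TInf (e : ℕ → X → ℂ) : Set (FormalSeries e) := {u | ∀ s : ℝ, u ∈ T e s}

/-- The norm of `T^s`. -/
def normT (s : ℝ) (u : FormalSeries e) : ℝ :=
  Real.sqrt (‖u.coeff 0‖ ^ 2 +
    (1 / 2) * ∑' n : ℕ, (1 + ((n : ℝ) + 1) ^ 2) ^ s * ‖u.coeff (n + 1)‖ ^ 2)

/-- The element `e_n` of the family, as a formal series. -/
def basis (e : ℕ → X → ℂ) (n : ℕ) : FormalSeries e where
  coeff := Pi.single n 1
  mem := ⟨0, by
    refine summable_of_ne_finset_zero (s := {n}) (fun m hm => ?_)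
    have : m ≠ n := by simpa using hm
    simp [this]⟩

/-- The formal series `u` is the function `g`: its coefficients are absolutely summable and it
converges pointwise to `g`. -/
def IsFun (u : FormalSeries e) (g : X → ℂ) : Prop :=
  (Summable fun n => ‖u.coeff n‖) ∧ ∀ x, HasSum (fun n => u.coeff n * e n x) (g x)

/-- The identification `∑ û_n e_n ↦ ∑ û_n f_n`. -/
def transport (e : ℕ → X → ℂ) (f : ℕ → Y → ℂ) : FormalSeries e ≃L[ℂ] FormalSeries f where
  toFun u := ⟨u.coeff, u.mem⟩
  invFun u := ⟨u.coeff, u.mem⟩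
  left_inv _ := rfl
  right_inv _ := rfl
  map_add' _ _ := rfl
  map_smul' _ _ := rfl
  continuous_toFun := continuous_induced_rng.2 continuous_induced_dom
  continuous_invFun := continuous_induced_rng.2 continuous_induced_dom

end FormalSeries

/-- The Chebyshev polynomials of the first kind, as functions on `[-1,1]`. -/
def chebT (n : ℕ) (x : Set.Icc (-1 : ℝ) 1) : ℂ :=
  (((Polynomial.Chebyshev.T ℝ n).eval (x : ℝ) : ℝ) : ℂ)

/-- `T^{-∞}` on the segment `[-1,1]`. -/
abbrev TNegInf : Type := FormalSeries chebT

/-! ### Smooth open curves -/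

/-- A smooth simple open curve in the plane, with its parametrization `r` of constant speed
`|Γ| / 2` on `[-1,1]` (so that `length` is the length `|Γ|`). -/
structure SmoothOpenArc : Type where
  /-- the parametrization; only its values on `[-1,1]` matter -/
  r : ℝ → EuclideanSpace ℝ (Fin 2)
  contDiffOn : ContDiffOn ℝ ∞ r (Set.Icc (-1) 1)
  injOn : Set.InjOn r (Set.Icc (-1) 1)
  /-- the length of the curve -/
  length : ℝ
  length_pos : 0 < length
  speed : ∀ x ∈ Set.Icc (-1 : ℝ) 1, ‖derivWithin r (Set.Icc (-1) 1) x‖ = length / 2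

namespace SmoothOpenArc

variable (Γ : SmoothOpenArc)

/-- The curve as a set of points. -/
def carrier : Set (EuclideanSpace ℝ (Fin 2)) := Γ.r '' Set.Icc (-1) 1

/-- The inverse `r⁻¹ : Γ → [-1,1]` of the parametrization. -/
def rInv (p : Γ.carrier) : Set.Icc (-1 : ℝ) 1 := ⟨p.2.choose, p.2.choose_spec.1⟩

/-- The functions `R_Γ⁻¹ T_n = T_n ∘ r⁻¹` on `Γ`. -/
def chebT (n : ℕ) (p : Γ.carrier) : ℂ := ArcPDO.chebT n (Γ.rInv p)

/-- `T^{-∞}(Γ)`. -/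
abbrev TNegInf : Type := FormalSeries Γ.chebT

/-- The pullback `R_Γ : ∑ û_n R_Γ⁻¹ T_n ↦ ∑ û_n T_n`. -/
def R : Γ.TNegInf ≃L[ℂ] ArcPDO.TNegInf := FormalSeries.transport Γ.chebT ArcPDO.chebT

/-- `R_Γ A R_Γ⁻¹`. -/
def conj (A : Γ.TNegInf →L[ℂ] Γ.TNegInf) : ArcPDO.TNegInf →L[ℂ] ArcPDO.TNegInf :=
  (Γ.R : Γ.TNegInf →L[ℂ] ArcPDO.TNegInf).comp
    (A.comp (Γ.R.symm : ArcPDO.TNegInf →L[ℂ] Γ.TNegInf))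

end SmoothOpenArc

/-! ### Periodic pseudo-differential operators

Functions on the torus are `2π`-periodic functions on `ℝ`; periodic distributions are given by
their Fourier coefficients. -/

/-- `e_n(θ) = exp(i n θ)`. -/
def expo (n : ℤ) (θ : ℝ) : ℂ := Complex.exp (Complex.I * n * θ)

/-- The Fourier coefficients `(1/2π) ∫_{-π}^{π} f(θ) exp(-i n θ) dθ`. -/
def fourierC (f : ℝ → ℂ) (n : ℤ) : ℂ :=
  (1 / (2 * (Real.pi : ℂ))) * ∫ θ in (-Real.pi)..Real.pi, f θ * expo (-n) θ

/-- Prolongated symbols of order `α`: smooth functions `σ(θ, ξ)` on `𝕋 × ℝ` with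
`|∂_θ^j ∂_ξ^k σ(θ, ξ)| ≤ C_{jk} (1 + |ξ|)^(α - k)`. -/
def IsProlongedSymbol (α : ℝ) (σ : ℝ → ℝ → ℂ) : Prop :=
  ContDiff ℝ ∞ (fun p : ℝ × ℝ => σ p.1 p.2) ∧
  (∀ θ ξ, σ (θ + 2 * Real.pi) ξ = σ θ ξ) ∧
  ∀ j k : ℕ, ∃ C : ℝ, 0 < C ∧ ∀ θ ξ : ℝ,
    ‖iteratedDeriv j (fun t => iteratedDeriv k (fun x => σ t x) ξ) θ‖
      ≤ C * (1 + |ξ|) ^ (α - k)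

/-- `Σ^α`: the symbols `σ(θ, n)`, `n ∈ ℤ`, that can be prolongated to a symbol of order `α`. -/
def symbolClass (α : ℝ) : Set (ℝ → ℤ → ℂ) :=
  {σ | ∃ τ : ℝ → ℝ → ℂ, IsProlongedSymbol α τ ∧ ∀ (θ : ℝ) (n : ℤ), σ θ n = τ θ n}

/-- `Op(σ)u (θ) = ∑_n σ(θ, n) û(n) exp(i n θ)`, where `û` are the Fourier coefficients of `u`. -/
def Op (σ : ℝ → ℤ → ℂ) (û : ℤ → ℂ) (θ : ℝ) : ℂ :=
  ∑' n : ℤ, σ θ n * û n * expo n θ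

/-- The symbol `exp(-i n θ) (C e_n)(θ)` of the composition `C = Op(σ) Op(τ)`. -/
def compSymbol (σ τ : ℝ → ℤ → ℂ) (θ : ℝ) (n : ℤ) : ℂ :=
  starRingEnd ℂ (expo n θ) * Op σ (fourierC (Op τ (fourierC (expo n)))) θ

/-- Ellipticity of a symbol of order `α`. -/
def IsEllipticSymbol (α : ℝ) (σ : ℝ → ℤ → ℂ) : Prop :=
  ∃ C : ℝ, 0 < C ∧ ∃ M : ℝ, ∀ (θ : ℝ) (n : ℤ), M ≤ |(n : ℝ)| →
    C * (1 + |(n : ℝ)|) ^ α ≤ ‖σ θ n‖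

/-- The operator `𝒞`, with `𝒞 T_n = cos(n ·)`: the Fourier coefficients of the even distribution
`𝒞 u = ∑ û_n cos(n ·)`. -/
def cosTransform (u : TNegInf) (n : ℤ) : ℂ :=
  if n = 0 then u.coeff 0 else u.coeff n.natAbs / 2

/-! ### Pseudo-differential operators on `T^{-∞}` and `T^{-∞}(Γ)` -/

/-- `σ̃(a₁, a₂)(θ, n) = a₁(cos θ, |n|) + i sin θ sign(n) a₂(cos θ, |n|)`. -/
def tildeSymbol (a₁ a₂ : ℝ → ℕ → ℂ) (θ : ℝ) (n : ℤ) : ℂ :=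
  a₁ (Real.cos θ) n.natAbs +
    Complex.I * (Real.sin θ : ℂ) * (n.sign : ℂ) * a₂ (Real.cos θ) n.natAbs

/-- `(a₁, a₂)` is a pair of symbols in `S^α_T` for the operator `A` on `T^{-∞}`:
`A T_n = a₁(x, n) T_n - ω² a₂(x, n) U_{n-1}` with `U_{-1} = 0`, and `σ̃(a₁, a₂) ∈ Σ^α`. -/
structure IsSymbolPair (α : ℝ) (A : TNegInf →L[ℂ] TNegInf) (a₁ a₂ : ℝ → ℕ → ℂ) : Prop where
  smooth₁ : ∀ n, ContDiffOn ℝ ∞ (fun x => a₁ x n) (Set.Icc (-1) 1)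
  smooth₂ : ∀ n, ContDiffOn ℝ ∞ (fun x => a₂ x n) (Set.Icc (-1) 1)
  apply_T : ∀ n : ℕ, (A (FormalSeries.basis chebT n)).IsFun (fun x =>
    a₁ x n * chebT n x -
      (((1 - (x : ℝ) ^ 2 : ℝ)) : ℂ) * a₂ x n *
        (((Polynomial.Chebyshev.U ℝ ((n : ℤ) - 1)).eval (x : ℝ) : ℝ) : ℂ))
  mem_class : tildeSymbol a₁ a₂ ∈ symbolClass α

/-- `(σ(θ, n) + σ(-θ, -n)) / 2`. -/
def symmetrize (σ : ℝ → ℤ → ℂ) (θ : ℝ) (n : ℤ) : ℂ := (σ θ n + σ (-θ) (-n)) / 2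

/-- `a₁(Ã)` for the operator `Ã` of symbol `σ`. -/
def firstSymbol (σ : ℝ → ℤ → ℂ) (x : ℝ) (n : ℕ) : ℂ :=
  (symmetrize σ (Real.arccos x) n + symmetrize σ (Real.arccos x) (-n)) / 2

/-- `a₂(Ã)` for the operator `Ã` of symbol `σ`: the quotient is `0 / 0` at `x = ±1`, where the
function is defined by continuity from `(-1,1)`. -/
def secondSymbol (σ : ℝ → ℤ → ℂ) (x : ℝ) (n : ℕ) : ℂ :=
  extendFrom (Set.Ioo (-1 : ℝ) 1) (fun y : ℝ =>
    (symmetrize σ (Real.arccos y) n - symmetrize σ (Real.arccos y) (-n)) /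
      (2 * Complex.I * (Real.sqrt (1 - y ^ 2) : ℂ))) x

/-- `(a₁, a₂) ∈ S^α_T` is a pair of symbols for the operator `A` on `T^{-∞}(Γ)`. -/
def IsSymbolPairOn (Γ : SmoothOpenArc) (α : ℝ) (A : Γ.TNegInf →L[ℂ] Γ.TNegInf)
    (a₁ a₂ : ℝ → ℕ → ℂ) : Prop :=
  IsSymbolPair α (Γ.conj A) a₁ a₂

/-- `Op(S^α_T(Γ))`. -/
def OpS (Γ : SmoothOpenArc) (α : ℝ) : Set (Γ.TNegInf →L[ℂ] Γ.TNegInf) :=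
  {A | ∃ a₁ a₂, IsSymbolPairOn Γ α A a₁ a₂}

/-- Ellipticity of an operator of order `α` on `T^{-∞}(Γ)`. -/
def IsEllipticOn (Γ : SmoothOpenArc) (α : ℝ) (A : Γ.TNegInf →L[ℂ] Γ.TNegInf) : Prop :=
  ∃ a₁ a₂, IsSymbolPairOn Γ α A a₁ a₂ ∧ IsEllipticSymbol α (tildeSymbol a₁ a₂)

end ArcPDO

end

open scoped ContDiff

noncomputable section

namespace ArcPDO

/-! ### Peetre's inequality -/

/-! Everything is transported to the circle by `x = cos θ`. There `T_n` becomes `cos nθ` and `(1 -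
x²) U_{n-1}` becomes `sin θ sin nθ`, so `a₁ T_n - (1 - x²) a₂ U_{n-1}` is exactly `Op(σ̃(a₁, a₂))`
applied to `cos(n ·)` (`pair_apply_cos`). Having a pair of symbols thus amounts to acting on cosines
as a periodic operator, which is the predicate `ActsBy`. Conversely, a symbol in `Σ^α` with `σ(-θ,
-n) = σ(θ, n)` always comes from a pair: its even part in `n` is a smooth even function of `θ`, its
odd part is `sin θ` times such a function, and smooth even periodic functions are smooth functions
of `cos θ` up to the endpoints (`tildeSymbol_firstSymbol_secondSymbol`). The statement therefore
reduces to a calculus on the circle.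

Composition: the symbol of `Op(σ) Op(τ)` is exactly `∑_k σ(θ, n + k) τ̂(k, n) e_k(θ)`. Replacing `n`
by a real `ξ` gives a prolongation. The shift by `k` costs a power of `1 + |k|` by Peetre's
inequality, while `τ̂(k, ξ)` decays faster than any such power, so the series converges in symbols
of order `α + β`. No asymptotic expansion is needed. For commutators, Fourier inversion gives `∑_k σ
τ̂(k, ·) e_k = σ τ`; subtracting it replaces `σ(θ, ξ + k)` by a difference, which is one order lower
by the mean value inequality, and the products `σ τ` and `τ σ` cancel.

Continuity: the same Fourier decay makes the matrix of `A` in the basis `T_n` concentrate near the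
diagonal, and Schur's test applies (`ActsBy.tsum_le`).

Ellipticity: a pair gives its own periodic operator, and weak-* continuity extends the identity from
the `T_n` to `T^∞`. In the other direction the given symbol need not be symmetric. Symmetrizing it
does not change its action on cosines, and, since the range of `𝒞` is even, the part removed has
order at most `α - 1` (`norm_sub_comp_neg_le`), so ellipticity survives. -/

lemma one_add_abs_pos (x : ℝ) : 0 < 1 + |x| := by positivity

/-- Peetre's inequality. -/
lemma peetre (α x y : ℝ) :
    (1 + |x + y|) ^ α ≤ (1 + |y|) ^ |α| * (1 + |x|) ^ α := by
  have hx := one_add_abs_pos x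
  have hy := one_add_abs_pos y
  have hxy := one_add_abs_pos (x + y)
  rcases le_total 0 α with h | h
  · rw [abs_of_nonneg h, ← Real.mul_rpow hy.le hx.le]
    refine Real.rpow_le_rpow hxy.le ?_ h
    nlinarith [abs_add_le x y, mul_nonneg (abs_nonneg x) (abs_nonneg y)]
  · obtain ⟨b, hb, rfl⟩ : ∃ b, 0 ≤ b ∧ α = -b := ⟨-α, by linarith, by ring⟩
    rw [abs_neg, abs_of_nonneg hb, Real.rpow_neg hxy.le, Real.rpow_neg hx.le,
      ← div_eq_mul_inv, le_div_iff₀ (Real.rpow_pos_of_pos hx b), inv_mul_le_iff₀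
      (Real.rpow_pos_of_pos hxy b), ← Real.mul_rpow hxy.le hy.le]
    refine Real.rpow_le_rpow hx.le ?_ hb
    have : |x| ≤ |x + y| + |y| := by simpa using abs_sub (x + y) y
    nlinarith [mul_nonneg (abs_nonneg (x + y)) (abs_nonneg y)]

lemma one_add_abs_rpow_le_of_le {a b : ℝ} (h : a ≤ b) (x : ℝ) :
    (1 + |x|) ^ a ≤ (1 + |x|) ^ b :=
  Real.rpow_le_rpow_of_exponent_le (by linarith [abs_nonneg x]) h

/-! ### Weighted families of symbols -/

variable {ι : Type*}

/-- `‖f k θ ξ‖ ≤ C w k (1 + |ξ|)^α`. -/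
def SymBound (w : ι → ℝ) (α : ℝ) (f : ι → ℝ → ℝ → ℂ) : Prop :=
  ∃ C : ℝ, ∀ k θ ξ, ‖f k θ ξ‖ ≤ C * w k * (1 + |ξ|) ^ α

/-- Symbol estimates with weight `w`, for all derivatives of total order at most `N`. -/
def Sym (w : ι → ℝ) : ℕ → ℝ → (ι → ℝ → ℝ → ℂ) → Prop
  | 0, α, f => SymBound w α f
  | N + 1, α, f => SymBound w α f ∧ ∃ g h : ι → ℝ → ℝ → ℂ,
      (∀ k θ ξ, HasDerivAt (fun t => f k t ξ) (g k θ ξ) θ) ∧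
      (∀ k θ ξ, HasDerivAt (fun x => f k θ x) (h k θ ξ) ξ) ∧
      Sym w N α g ∧ Sym w N (α - 1) h

lemma Sym.bound {w : ι → ℝ} {N : ℕ} {α : ℝ} {f : ι → ℝ → ℝ → ℂ} (h : Sym w N α f) :
    SymBound w α f := by
  cases N with
  | zero => exact h
  | succ N => exact h.1

lemma SymBound.add {w : ι → ℝ} {α : ℝ} {f g : ι → ℝ → ℝ → ℂ} (hf : SymBound w α f)
    (hg : SymBound w α g) : SymBound w α (fun k θ ξ => f k θ ξ + g k θ ξ) := by
  obtain ⟨C, hC⟩ := hf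
  obtain ⟨D, hD⟩ := hg
  refine ⟨C + D, fun k θ ξ => (norm_add_le _ _).trans ?_⟩
  calc _ ≤ _ := add_le_add (hC k θ ξ) (hD k θ ξ)
    _ = _ := by ring

lemma SymBound.mul {w v : ι → ℝ} {α β : ℝ} {f g : ι → ℝ → ℝ → ℂ} (hf : SymBound w α f)
    (hg : SymBound v β g) :
    SymBound (fun k => w k * v k) (α + β) (fun k θ ξ => f k θ ξ * g k θ ξ) := by
  obtain ⟨C, hC⟩ := hf
  obtain ⟨D, hD⟩ := hg
  refine ⟨C * D, fun k θ ξ => ?_⟩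
  rw [norm_mul, Real.rpow_add (one_add_abs_pos ξ)]
  calc _ ≤ _ := mul_le_mul (hC k θ ξ) (hD k θ ξ) (norm_nonneg _) ((norm_nonneg _).trans (hC k θ ξ))
    _ = _ := by ring

lemma SymBound.mono {w v : ι → ℝ} {α β : ℝ} {f : ι → ℝ → ℝ → ℂ} (hf : SymBound w α f)
    (hw : ∀ k, 0 ≤ w k) (hwv : ∀ k, w k ≤ v k) (h : α ≤ β) : SymBound v β f := by
  obtain ⟨C, hC⟩ := hf
  refine ⟨|C|, fun k θ ξ => (hC k θ ξ).trans ?_⟩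
  exact mul_le_mul (mul_le_mul (le_abs_self C) (hwv k) (hw k) (abs_nonneg C))
    (one_add_abs_rpow_le_of_le h ξ) (Real.rpow_nonneg (one_add_abs_pos ξ).le _)
    (mul_nonneg (abs_nonneg C) ((hw k).trans (hwv k)))

lemma Sym.mono {w v : ι → ℝ} {N : ℕ} {α β : ℝ} {f : ι → ℝ → ℝ → ℂ} (hf : Sym w N α f)
    (hw : ∀ k, 0 ≤ w k) (hwv : ∀ k, w k ≤ v k) (h : α ≤ β) : Sym v N β f := by
  induction N generalizing α β f with
  | zero => exact SymBound.mono hf hw hwv h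
  | succ N ih =>
    obtain ⟨hb, g, k, hg, hk, sg, sk⟩ := hf
    exact ⟨hb.mono hw hwv h, g, k, hg, hk, ih sg h, ih sk (by linarith)⟩

lemma Sym.of_succ {w : ι → ℝ} {N : ℕ} {α : ℝ} {f : ι → ℝ → ℝ → ℂ} (hf : Sym w (N + 1) α f) :
    Sym w N α f := by
  induction N generalizing α f with
  | zero => exact hf.1
  | succ N ih =>
    obtain ⟨hb, g, k, hg, hk, sg, sk⟩ := hf
    exact ⟨hb, g, k, hg, hk, ih sg, ih sk⟩

lemma Sym.add {w : ι → ℝ} {N : ℕ} {α : ℝ} {f g : ι → ℝ → ℝ → ℂ} (hf : Sym w N α f)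
    (hg : Sym w N α g) : Sym w N α (fun k θ ξ => f k θ ξ + g k θ ξ) := by
  induction N generalizing α f g with
  | zero => exact SymBound.add hf hg
  | succ N ih =>
    obtain ⟨hb, g₁, k₁, hg₁, hk₁, sg₁, sk₁⟩ := hf
    obtain ⟨hb', g₂, k₂, hg₂, hk₂, sg₂, sk₂⟩ := hg
    exact ⟨hb.add hb', _, _, fun k θ ξ => (hg₁ k θ ξ).add (hg₂ k θ ξ),
      fun k θ ξ => (hk₁ k θ ξ).add (hk₂ k θ ξ), ih sg₁ sg₂, ih sk₁ sk₂⟩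

/-- Leibniz rule. Orders add and weights multiply, so polynomial growth in an index `k` can later be
absorbed by rapid decay of another factor. -/
lemma Sym.mul {w v : ι → ℝ} {N : ℕ} {α β : ℝ} {f g : ι → ℝ → ℝ → ℂ} (hf : Sym w N α f)
    (hg : Sym v N β g) :
    Sym (fun k => w k * v k) N (α + β) (fun k θ ξ => f k θ ξ * g k θ ξ) := by
  induction N generalizing α β f g with
  | zero => exact SymBound.mul hf hg
  | succ N ih =>
    have hf' := hf.of_succ
    have hg' := hg.of_succ
    obtain ⟨hb, g₁, k₁, hg₁, hk₁, sg₁, sk₁⟩ := hf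
    obtain ⟨hb', g₂, k₂, hg₂, hk₂, sg₂, sk₂⟩ := hg
    refine ⟨hb.mul hb', _, _, fun k θ ξ => (hg₁ k θ ξ).mul (hg₂ k θ ξ),
      fun k θ ξ => (hk₁ k θ ξ).mul (hk₂ k θ ξ), (ih sg₁ hg').add (ih hf' sg₂), ?_⟩
    have h1 := ih sk₁ hg'
    have h2 := ih hf' sk₂
    rw [show α - 1 + β = α + β - 1 by ring] at h1
    rw [show α + (β - 1) = α + β - 1 by ring] at h2
    exact h1.add h2

lemma sym_zero (w : ι → ℝ) (N : ℕ) (α : ℝ) :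
    Sym w N α (fun (_ : ι) (_ _ : ℝ) => (0 : ℂ)) := by
  induction N generalizing α with
  | zero => exact ⟨0, by simp⟩
  | succ N ih =>
    exact ⟨⟨0, by simp⟩, _, _, fun k θ ξ => hasDerivAt_const _ _,
      fun k θ ξ => hasDerivAt_const _ _, ih _, ih _⟩

/-- Families that do not depend on `(θ, ξ)`. -/
lemma sym_const (c : ι → ℂ) (N : ℕ) {α : ℝ} (hα : 0 ≤ α) {w : ι → ℝ} (hc : ∀ k, ‖c k‖ ≤ w k) :
    Sym w N α (fun k _ _ => c k) := by
  have hb : SymBound w α (fun k _ _ => c k) := by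
    refine ⟨1, fun k θ ξ => ?_⟩
    have h1 : (1 : ℝ) ≤ (1 + |ξ|) ^ α :=
      Real.one_le_rpow (by linarith [abs_nonneg ξ]) hα
    nlinarith [hc k, norm_nonneg (c k)]
  cases N with
  | zero => exact hb
  | succ N =>
    exact ⟨hb, _, _, fun k θ ξ => hasDerivAt_const _ _, fun k θ ξ => hasDerivAt_const _ _,
      sym_zero _ _ _, sym_zero _ _ _⟩

lemma SymBound.summable {w : ι → ℝ} {α : ℝ} {f : ι → ℝ → ℝ → ℂ} (hf : SymBound w α f)
    (hw : Summable w) (θ ξ : ℝ) : Summable fun k => f k θ ξ := by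
  obtain ⟨C, hC⟩ := hf
  exact Summable.of_norm_bounded ((hw.mul_left C).mul_right _) (fun k => hC k θ ξ)

/-- Summation of a family of symbols with summable weights. -/
lemma Sym.tsum {w : ι → ℝ} {N : ℕ} {α : ℝ} {f : ι → ℝ → ℝ → ℂ} (hf : Sym w N α f)
    (hw : Summable w) :
    Sym (fun _ : Unit => 1) N α (fun _ θ ξ => ∑' k, f k θ ξ) := by
  have hbd : ∀ {α : ℝ} {f : ι → ℝ → ℝ → ℂ}, SymBound w α f →
      SymBound (fun _ : Unit => 1) α (fun _ θ ξ => ∑' k, f k θ ξ) := by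
    rintro α f ⟨C, hC⟩
    refine ⟨∑' k, C * w k, fun _ θ ξ => ?_⟩
    rw [mul_one, ← tsum_mul_right]
    exact tsum_of_norm_bounded ((hw.mul_left C).mul_right _).hasSum (fun k => hC k θ ξ)
  induction N generalizing α f with
  | zero => exact hbd hf
  | succ N ih =>
    obtain ⟨hb, g, h, hg, hh, sg, sh⟩ := hf
    refine ⟨hbd hb, fun _ θ ξ => ∑' k, g k θ ξ, fun _ θ ξ => ∑' k, h k θ ξ, ?_, ?_,
      ih sg, ih sh⟩
    · intro _ θ ξ
      obtain ⟨C, hC⟩ := sg.bound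
      exact hasDerivAt_tsum (y₀ := θ) ((hw.mul_left C).mul_right ((1 + |ξ|) ^ α))
        (fun k t => hg k t ξ) (fun k t => hC k t ξ) (hb.summable hw θ ξ) θ
    · intro _ θ ξ
      obtain ⟨C, hC⟩ := sh.bound
      -- The bound on the `θ`-derivatives is uniform in `θ`, but the one on the `ξ`-derivatives is
      -- only locally uniform in `ξ`: on a unit ball Peetre's inequality costs the factor `2 ^ |α -
      -- 1|`.
      have hξ : ξ ∈ Metric.ball ξ 1 := Metric.mem_ball_self one_pos
      refine hasDerivAt_tsum_of_isPreconnected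
        (u := fun k => |C * w k| * (2 ^ |α - 1| * (1 + |ξ|) ^ (α - 1)))
        ((hw.mul_left C).abs.mul_right _)
        Metric.isOpen_ball (convex_ball ξ 1).isPreconnected (fun k t _ => hh k θ t)
        (fun k t ht => (hC k θ t).trans ?_) hξ (hb.summable hw θ ξ) hξ
      have h1 := peetre (α - 1) ξ (t - ξ)
      rw [add_sub_cancel] at h1
      have h2 : (1 + |t - ξ|) ^ |α - 1| ≤ 2 ^ |α - 1| := by
        refine Real.rpow_le_rpow (one_add_abs_pos _).le ?_ (abs_nonneg _)
        rw [Metric.mem_ball, Real.dist_eq] at ht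
        linarith
      exact mul_le_mul (le_abs_self _) (h1.trans (mul_le_mul_of_nonneg_right h2
        (Real.rpow_nonneg (one_add_abs_pos _).le _)))
        (Real.rpow_nonneg (one_add_abs_pos _).le _) (abs_nonneg _)

/-- The family `(k, θ, ξ) ↦ f(θ, ξ + k)`. -/
lemma Sym.shift {N : ℕ} {α : ℝ} {f : ℝ → ℝ → ℂ}
    (hf : Sym (fun _ : Unit => 1) N α (fun _ => f)) {L : ℝ} (hL : |α| + N ≤ L) :
    Sym (fun k : ℤ => (1 + |(k : ℝ)|) ^ L) N α (fun k θ ξ => f θ (ξ + k)) := by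
  have hbd : ∀ {α : ℝ} {f : ℝ → ℝ → ℂ}, |α| ≤ L → SymBound (fun _ : Unit => 1) α (fun _ => f) →
      SymBound (fun k : ℤ => (1 + |(k : ℝ)|) ^ L) α (fun k θ ξ => f θ (ξ + k)) := by
    rintro α f hL ⟨C, hC⟩
    refine ⟨|C|, fun k θ ξ => (hC () θ _).trans ?_⟩
    rw [mul_one, mul_assoc]
    exact mul_le_mul (le_abs_self C) ((peetre α ξ k).trans (mul_le_mul_of_nonneg_right
      (one_add_abs_rpow_le_of_le hL _) (Real.rpow_nonneg (one_add_abs_pos _).le _)))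
      (Real.rpow_nonneg (one_add_abs_pos _).le _) (abs_nonneg _)
  induction N generalizing α f with
  | zero => exact hbd (by simpa using hL) hf
  | succ N ih =>
    obtain ⟨hb, g, h, hg, hh, sg, sh⟩ := hf
    push_cast at hL
    have hN : (0 : ℝ) ≤ N := N.cast_nonneg
    refine ⟨hbd (by linarith) hb, fun k θ ξ => g () θ (ξ + k), fun k θ ξ => h () θ (ξ + k),
      fun k θ ξ => hg () θ _, fun k θ ξ => ?_, ih sg (by linarith), ih sh ?_⟩
    · exact (hh () θ (ξ + k)).comp_add_const ξ k
    -- Each `ξ`-derivative lowers the order by one and so may raise its absolute value by one; this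
    -- is the `N` in `|α| + N ≤ L`.
    · have : |α - 1| ≤ |α| + 1 := by simpa using abs_sub α 1
      linarith

/-- The family `(k, θ, ξ) ↦ f(θ, ξ + k) - f(θ, ξ)`. -/
lemma Sym.shift_sub {N : ℕ} {α : ℝ} {f : ℝ → ℝ → ℂ}
    (hf : Sym (fun _ : Unit => 1) (N + 1) α (fun _ => f)) {L : ℝ} (hL : |α| + N + 2 ≤ L) :
    Sym (fun k : ℤ => (1 + |(k : ℝ)|) ^ L) N (α - 1) (fun k θ ξ => f θ (ξ + k) - f θ ξ) := by
  have hbd : ∀ {α : ℝ} {f : ℝ → ℝ → ℂ}, |α - 1| + 1 ≤ L →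
      Sym (fun _ : Unit => 1) 1 α (fun _ => f) →
      SymBound (fun k : ℤ => (1 + |(k : ℝ)|) ^ L) (α - 1)
        (fun k θ ξ => f θ (ξ + k) - f θ ξ) := by
    rintro α f hL ⟨-, g, h, -, hh, -, C, hC⟩
    refine ⟨|C|, fun k θ ξ => ?_⟩
    -- Mean value inequality along the segment from `ξ` to `ξ + k`: the derivative has order `α -
    -- 1`, Peetre's inequality compares it with its size at `ξ`, and the length `|k|` costs one more
    -- power of the weight.
    set B : ℝ := |C| * ((1 + |(k : ℝ)|) ^ |α - 1| * (1 + |ξ|) ^ (α - 1))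
    have hB : ∀ x ∈ segment ℝ ξ (ξ + k), ‖h () θ x‖ ≤ B := by
      intro x hx
      rw [segment_eq_image'] at hx
      obtain ⟨t, ht, rfl⟩ := hx
      refine (hC () θ _).trans ?_
      rw [mul_one]
      refine mul_le_mul (le_abs_self C) ((peetre (α - 1) ξ _).trans
        (mul_le_mul_of_nonneg_right (Real.rpow_le_rpow (one_add_abs_pos _).le ?_ (abs_nonneg _))
        (Real.rpow_nonneg (one_add_abs_pos _).le _)))
        (Real.rpow_nonneg (one_add_abs_pos _).le _) (abs_nonneg _)
      rw [add_sub_cancel_left, smul_eq_mul, abs_mul, abs_of_nonneg ht.1]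
      nlinarith [abs_nonneg (k : ℝ), ht.2]
    have h1 := (convex_segment ξ (ξ + k)).norm_image_sub_le_of_norm_hasDerivWithin_le
      (fun x _ => (hh () θ x).hasDerivWithinAt) hB (left_mem_segment ℝ _ _)
      (right_mem_segment ℝ _ _)
    rw [add_sub_cancel_left, Real.norm_eq_abs] at h1
    refine h1.trans ?_
    have h2 : (1 + |(k : ℝ)|) ^ |α - 1| * |(k : ℝ)| ≤ (1 + |(k : ℝ)|) ^ L := by
      have h3 := one_add_abs_rpow_le_of_le hL (k : ℝ)
      rw [Real.rpow_add (one_add_abs_pos _), Real.rpow_one] at h3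
      refine le_trans ?_ h3
      exact mul_le_mul_of_nonneg_left (by linarith) (Real.rpow_nonneg (one_add_abs_pos _).le _)
    calc B * |(k : ℝ)| = |C| * (((1 + |(k : ℝ)|) ^ |α - 1| * |(k : ℝ)|) * (1 + |ξ|) ^ (α - 1)) := by
          ring
      _ ≤ |C| * ((1 + |(k : ℝ)|) ^ L * (1 + |ξ|) ^ (α - 1)) := by
          gcongr
      _ = _ := by ring
  have key : ∀ α : ℝ, |α - 1| ≤ |α| + 1 := fun α => by simpa using abs_sub α 1
  induction N generalizing α f with
  | zero =>
    refine hbd ?_ hf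
    have := key α
    push_cast at hL; linarith
  | succ N ih =>
    have hN : (0 : ℝ) ≤ N := N.cast_nonneg
    push_cast at hL
    have hf1 : Sym (fun _ : Unit => 1) 1 α (fun _ => f) := by
      clear ih hL
      induction N with
      | zero => exact hf.of_succ
      | succ N ihN => exact ihN hf.of_succ N.cast_nonneg
    obtain ⟨hb, g, h, hg, hh, sg, sh⟩ := hf
    have := key α
    refine ⟨hbd (by linarith) hf1, fun k θ ξ => g () θ (ξ + k) - g () θ ξ,
      fun k θ ξ => h () θ (ξ + k) - h () θ ξ,
      fun k θ ξ => (hg () θ _).sub (hg () θ _), fun k θ ξ => ?_, ih sg (by linarith),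
      ih sh (by linarith)⟩
    exact ((hh () θ (ξ + k)).comp_add_const ξ k).sub (hh () θ ξ)

/-! ### Comparison with prolongated symbols -/

/-- The bound on the `θ`-derivative makes `f` Lipschitz in `θ`, locally uniformly in `ξ`; it then
suffices to have continuity in `ξ` along the single line `θ = θ₀`. -/
lemma Sym.continuous {α : ℝ} {f : ℝ → ℝ → ℂ}
    (hf : Sym (fun _ : Unit => 1) 1 α (fun _ => f)) :
    Continuous (fun p : ℝ × ℝ => f p.1 p.2) := by
  obtain ⟨-, g, h, hg, hh, ⟨C, hC⟩, -⟩ := hf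
  rw [continuous_iff_continuousAt]
  rintro ⟨θ₀, ξ₀⟩
  have h1 : Filter.Tendsto (fun p : ℝ × ℝ => f p.1 p.2 - f θ₀ p.2) (nhds (θ₀, ξ₀)) (nhds 0) := by
    have hc : Continuous (fun p : ℝ × ℝ => C * 1 * (1 + |p.2|) ^ α * ‖p.1 - θ₀‖) := by
      refine Continuous.mul (Continuous.mul continuous_const ?_) (by fun_prop)
      exact Continuous.rpow_const (by fun_prop) (fun p => Or.inl (one_add_abs_pos _).ne')
    have h0 := hc.tendsto (θ₀, ξ₀)
    simp only [sub_self, norm_zero, mul_zero] at h0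
    refine squeeze_zero_norm (fun p => ?_) h0
    exact convex_univ.norm_image_sub_le_of_norm_hasDerivWithin_le
      (fun x _ => (hg () x p.2).hasDerivWithinAt) (fun x _ => hC () x p.2)
      (Set.mem_univ _) (Set.mem_univ _)
  have h2 : ContinuousAt (fun p : ℝ × ℝ => f θ₀ p.2) (θ₀, ξ₀) :=
    ContinuousAt.comp (f := fun p : ℝ × ℝ => p.2) (g := fun x => f θ₀ x)
      (hh () θ₀ ξ₀).continuousAt continuousAt_snd
  have h3 := h1.add h2.tendsto
  simpa [ContinuousAt] using h3

/-- Continuous partial derivatives give a Fréchet derivative. One level is lost because continuity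
itself is read off from a derivative bound. -/
lemma Sym.contDiff {N : ℕ} {α : ℝ} {f : ℝ → ℝ → ℂ}
    (hf : Sym (fun _ : Unit => 1) (N + 1) α (fun _ => f)) :
    ContDiff ℝ N (fun p : ℝ × ℝ => f p.1 p.2) := by
  induction N generalizing α f with
  | zero => exact contDiff_zero.2 hf.continuous
  | succ N ih =>
    obtain ⟨-, g, h, hg, hh, sg, sh⟩ := hf
    have cg := ih (f := g ()) sg
    have ch := ih (f := h ()) sh
    have hder : ∀ p : ℝ × ℝ, HasFDerivAt (fun p : ℝ × ℝ => f p.1 p.2)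
        ((ContinuousLinearMap.toSpanSingleton ℝ (g () p.1 p.2)).coprod
          (ContinuousLinearMap.toSpanSingleton ℝ (h () p.1 p.2))) p := by
      intro p
      refine (hasStrictFDerivAt_uncurry_coprod (f := f)
        (f₁ := fun a b => ContinuousLinearMap.toSpanSingleton ℝ (g () a b))
        (f₂ := fun a b => ContinuousLinearMap.toSpanSingleton ℝ (h () a b))
        (Filter.Eventually.of_forall fun v => (hg () v.1 v.2).hasFDerivAt)
        (Filter.Eventually.of_forall fun v => (hh () v.1 v.2).hasFDerivAt) ?_ ?_).hasFDerivAt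
      · exact ((ContinuousLinearMap.toSpanSingletonCLE (𝕜 := ℝ) (E := ℂ)).continuous.comp
          cg.continuous).continuousAt
      · exact ((ContinuousLinearMap.toSpanSingletonCLE (𝕜 := ℝ) (E := ℂ)).continuous.comp
          ch.continuous).continuousAt
    rw [show ((N + 1 : ℕ) : WithTop ℕ∞) = (N : WithTop ℕ∞) + 1 by push_cast; rfl,
      contDiff_succ_iff_hasFDerivAt]
    refine ⟨_, ?_, hder⟩
    rw [contDiff_clm_apply_iff]
    rintro ⟨a, b⟩
    simp only [ContinuousLinearMap.coprod_apply, ContinuousLinearMap.toSpanSingleton_apply]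
    exact (contDiff_const.smul cg).add (contDiff_const.smul ch)

lemma Sym.iteratedDeriv_snd {N : ℕ} {α : ℝ} {f : ℝ → ℝ → ℂ} (k : ℕ)
    (hf : Sym (fun _ : Unit => 1) (N + k) α (fun _ => f)) :
    Sym (fun _ : Unit => 1) N (α - k) (fun _ θ ξ => iteratedDeriv k (fun x => f θ x) ξ) := by
  induction k generalizing α f with
  | zero => simpa using hf
  | succ k ih =>
    obtain ⟨-, g, h, -, hh, -, sh⟩ := hf
    have h1 := ih (f := h ()) sh
    have h2 : ∀ θ, deriv (fun x => f θ x) = h () θ := fun θ => funext fun ξ => (hh () θ ξ).deriv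
    simp only [iteratedDeriv_succ', h2]
    push_cast
    rwa [show α - (k + 1 : ℝ) = α - 1 - k by ring]

lemma Sym.iteratedDeriv_fst {N : ℕ} {α : ℝ} {f : ℝ → ℝ → ℂ} (j : ℕ)
    (hf : Sym (fun _ : Unit => 1) (N + j) α (fun _ => f)) :
    Sym (fun _ : Unit => 1) N α (fun _ θ ξ => iteratedDeriv j (fun t => f t ξ) θ) := by
  induction j generalizing α f with
  | zero => simpa using hf
  | succ j ih =>
    obtain ⟨-, g, h, hg, -, sg, -⟩ := hf
    have h1 := ih (f := g ()) sg
    have h2 : ∀ ξ, deriv (fun t => f t ξ) = fun t => g () t ξ :=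
      fun ξ => funext fun θ => (hg () θ ξ).deriv
    simp only [iteratedDeriv_succ', h2]
    exact h1

/-- Periodic functions satisfying all the symbol estimates of order `α`. -/
structure IsPeriodicSym (α : ℝ) (f : ℝ → ℝ → ℂ) : Prop where
  sym : ∀ N, Sym (fun _ : Unit => 1) N α (fun _ => f)
  periodic : ∀ θ ξ, f (θ + 2 * Real.pi) ξ = f θ ξ

lemma IsPeriodicSym.isProlongedSymbol {α : ℝ} {f : ℝ → ℝ → ℂ} (hf : IsPeriodicSym α f) :
    IsProlongedSymbol α f := by
  refine ⟨contDiff_infty.2 fun N => (hf.sym (N + 1)).contDiff, hf.periodic, fun j k => ?_⟩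
  have h1 := hf.sym (0 + j + k)
  obtain ⟨C, hC⟩ := ((h1.iteratedDeriv_snd k).iteratedDeriv_fst j).bound
  refine ⟨|C| + 1, by positivity, fun θ ξ => (hC () θ ξ).trans ?_⟩
  refine mul_le_mul_of_nonneg_right ?_ (Real.rpow_nonneg (one_add_abs_pos _).le _)
  rw [mul_one]
  linarith [le_abs_self C]

/-! ### Commuting partial derivatives of smooth functions of two variables. -/

section Partials

variable {f : ℝ × ℝ → ℂ}

lemma hasDerivAt_fst_of_contDiff (hf : ContDiff ℝ ∞ f) (θ ξ : ℝ) :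
    HasDerivAt (fun t => f (t, ξ)) (fderiv ℝ f (θ, ξ) (1, 0)) θ := by
  have h1 := ((hf.differentiable (by simp)) (θ, ξ)).hasFDerivAt
  exact h1.comp_hasDerivAt θ ((hasDerivAt_id θ).prodMk (hasDerivAt_const θ ξ))

lemma hasDerivAt_snd_of_contDiff (hf : ContDiff ℝ ∞ f) (θ ξ : ℝ) :
    HasDerivAt (fun x => f (θ, x)) (fderiv ℝ f (θ, ξ) (0, 1)) ξ := by
  have h1 := ((hf.differentiable (by simp)) (θ, ξ)).hasFDerivAt
  exact h1.comp_hasDerivAt ξ ((hasDerivAt_const ξ θ).prodMk (hasDerivAt_id ξ))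

lemma contDiff_fderiv_apply_const (hf : ContDiff ℝ ∞ f) (v : ℝ × ℝ) :
    ContDiff ℝ ∞ (fun p => fderiv ℝ f p v) :=
  (hf.fderiv_right (m := ∞) (by simp)).clm_apply contDiff_const

lemma fderiv_fderiv_comm (hf : ContDiff ℝ ∞ f) (v w p : ℝ × ℝ) :
    fderiv ℝ (fun q => fderiv ℝ f q v) p w = fderiv ℝ (fun q => fderiv ℝ f q w) p v := by
  have hd : DifferentiableAt ℝ (fderiv ℝ f) p :=
    ((hf.fderiv_right (m := ∞) (by simp)).differentiable (by simp)) p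
  have h1 : ∀ v w, fderiv ℝ (fun q => fderiv ℝ f q v) p w = fderiv ℝ (fderiv ℝ f) p w v := by
    intro v w
    rw [fderiv_clm_apply hd (differentiableAt_const v)]
    simp
  rw [h1, h1]
  exact (hf.contDiffAt.isSymmSndFDerivAt (by simp; exact WithTop.coe_le_coe.2 le_top)) w v

lemma iteratedDeriv_fderiv_comm (hf : ContDiff ℝ ∞ f) (k : ℕ) (θ ξ : ℝ) :
    HasDerivAt (fun t => iteratedDeriv k (fun x => f (t, x)) ξ)
      (iteratedDeriv k (fun x => fderiv ℝ f (θ, x) (1, 0)) ξ) θ := by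
  induction k generalizing f with
  | zero => simpa using hasDerivAt_fst_of_contDiff hf θ ξ
  | succ k ih =>
    have h1 := ih (contDiff_fderiv_apply_const hf (0, 1))
    have h2 : ∀ t, deriv (fun x => f (t, x)) = fun x => fderiv ℝ f (t, x) (0, 1) :=
      fun t => funext fun x => (hasDerivAt_snd_of_contDiff hf t x).deriv
    have h3 : deriv (fun x => fderiv ℝ f (θ, x) (1, 0)) =
        fun x => fderiv ℝ (fun q => fderiv ℝ f q (0, 1)) (θ, x) (1, 0) := by
      funext x
      rw [(hasDerivAt_snd_of_contDiff (contDiff_fderiv_apply_const hf (1, 0)) θ x).deriv]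
      exact fderiv_fderiv_comm hf _ _ _
    simp only [iteratedDeriv_succ', h2, h3]
    exact h1

end Partials

/-- `IsProlongedSymbol` takes all `ξ`-derivatives before the `θ`-derivatives, whereas `Sym` takes
them in any order; symmetry of second derivatives reconciles the two. -/
lemma sym_of_bounds {α : ℝ} {f : ℝ × ℝ → ℂ} (hf : ContDiff ℝ ∞ f)
    (hb : ∀ j k : ℕ, ∃ C : ℝ, ∀ θ ξ : ℝ,
      ‖iteratedDeriv j (fun t => iteratedDeriv k (fun x => f (t, x)) ξ) θ‖
        ≤ C * (1 + |ξ|) ^ (α - k)) (N : ℕ) :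
    Sym (fun _ : Unit => 1) N α (fun _ θ ξ => f (θ, ξ)) := by
  have h0 : ∀ {α : ℝ} {f : ℝ × ℝ → ℂ}, (∀ j k : ℕ, ∃ C : ℝ, ∀ θ ξ : ℝ,
      ‖iteratedDeriv j (fun t => iteratedDeriv k (fun x => f (t, x)) ξ) θ‖
        ≤ C * (1 + |ξ|) ^ (α - k)) →
      SymBound (fun _ : Unit => 1) α (fun _ θ ξ => f (θ, ξ)) := by
    intro α f hb
    obtain ⟨C, hC⟩ := hb 0 0
    exact ⟨C, fun _ θ ξ => by simpa using hC θ ξ⟩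
  induction N generalizing α f with
  | zero => exact h0 hb
  | succ N ih =>
    refine ⟨h0 hb, fun _ θ ξ => fderiv ℝ f (θ, ξ) (1, 0), fun _ θ ξ => fderiv ℝ f (θ, ξ) (0, 1),
      fun _ θ ξ => hasDerivAt_fst_of_contDiff hf θ ξ,
      fun _ θ ξ => hasDerivAt_snd_of_contDiff hf θ ξ,
      ih (contDiff_fderiv_apply_const hf (1, 0)) fun j k => ?_,
      ih (contDiff_fderiv_apply_const hf (0, 1)) fun j k => ?_⟩
    · obtain ⟨C, hC⟩ := hb (j + 1) k
      refine ⟨C, fun θ ξ => ?_⟩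
      have h1 : deriv (fun t => iteratedDeriv k (fun x => f (t, x)) ξ) =
          fun t => iteratedDeriv k (fun x => fderiv ℝ f (t, x) (1, 0)) ξ :=
        funext fun t => (iteratedDeriv_fderiv_comm hf k t ξ).deriv
      rw [← h1, ← iteratedDeriv_succ']
      exact hC θ ξ
    · obtain ⟨C, hC⟩ := hb j (k + 1)
      refine ⟨C, fun θ ξ => ?_⟩
      have h1 : ∀ t, deriv (fun x => f (t, x)) = fun x => fderiv ℝ f (t, x) (0, 1) :=
        fun t => funext fun x => (hasDerivAt_snd_of_contDiff hf t x).deriv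
      have h2 := hC θ ξ
      simp only [iteratedDeriv_succ', h1] at h2
      push_cast at h2
      rwa [show α - (k + 1 : ℝ) = α - 1 - k by ring] at h2

lemma IsProlongedSymbol.isPeriodicSym {α : ℝ} {f : ℝ → ℝ → ℂ} (hf : IsProlongedSymbol α f) :
    IsPeriodicSym α f :=
  ⟨fun N => sym_of_bounds (f := fun p => f p.1 p.2) hf.1
    (fun j k => (hf.2.2 j k).imp fun _ h => h.2) N, hf.2.1⟩

lemma mem_symbolClass_iff {α : ℝ} {σ : ℝ → ℤ → ℂ} :
    σ ∈ symbolClass α ↔ ∃ τ : ℝ → ℝ → ℂ, IsPeriodicSym α τ ∧ ∀ (θ : ℝ) (n : ℤ), σ θ n = τ θ n :=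
  ⟨fun ⟨τ, h, e⟩ => ⟨τ, h.isPeriodicSym, e⟩, fun ⟨τ, h, e⟩ => ⟨τ, h.isProlongedSymbol, e⟩⟩

/-- The partial derivatives of a symbol of order `α` are symbols of order `α` and `α - 1`. -/
lemma IsPeriodicSym.exists_partials {α : ℝ} {f : ℝ → ℝ → ℂ} (hf : IsPeriodicSym α f) :
    ∃ g h : ℝ → ℝ → ℂ, (∀ θ ξ, HasDerivAt (fun t => f t ξ) (g θ ξ) θ) ∧
      (∀ θ ξ, HasDerivAt (fun x => f θ x) (h θ ξ) ξ) ∧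
      IsPeriodicSym α g ∧ IsPeriodicSym (α - 1) h := by
  obtain ⟨-, g, h, hg, hh, -, -⟩ := hf.sym 1
  -- `Sym` provides partial derivatives separately for each `N`; uniqueness of derivatives
  -- identifies them with those chosen at the first level.
  refine ⟨g (), h (), hg (), hh (), ⟨fun N => ?_, fun θ ξ => ?_⟩, ⟨fun N => ?_, fun θ ξ => ?_⟩⟩
  · obtain ⟨-, g', h', hg', hh', sg, sh⟩ := hf.sym (N + 1)
    have : g' = fun _ => g () := by
      funext u θ ξ; exact (hg' u θ ξ).unique (hg () θ ξ)
    rwa [this] at sg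
  · have h1 := (hg () (θ + 2 * Real.pi) ξ).comp_add_const θ (2 * Real.pi)
    simp only [hf.periodic] at h1
    exact h1.unique (hg () θ ξ)
  · obtain ⟨-, g', h', hg', hh', sg, sh⟩ := hf.sym (N + 1)
    have : h' = fun _ => h () := by
      funext u θ ξ; exact (hh' u θ ξ).unique (hh () θ ξ)
    rwa [this] at sh
  · have h1 := hh () (θ + 2 * Real.pi) ξ
    simp only [hf.periodic] at h1
    exact h1.unique (hh () θ ξ)

/-! ### Fourier series -/

lemma expo_zero (θ : ℝ) : expo 0 θ = 1 := by simp [expo]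

lemma expo_add (m n : ℤ) (θ : ℝ) : expo (m + n) θ = expo m θ * expo n θ := by
  rw [expo, expo, expo, ← Complex.exp_add]
  push_cast
  ring_nf

lemma expo_neg_right (n : ℤ) (θ : ℝ) : expo n (-θ) = expo (-n) θ := by
  rw [expo, expo]
  push_cast
  ring_nf

lemma conj_expo (n : ℤ) (θ : ℝ) : starRingEnd ℂ (expo n θ) = expo (-n) θ := by
  rw [expo, expo, ← Complex.exp_conj]
  simp

@[simp] lemma norm_expo (n : ℤ) (θ : ℝ) : ‖expo n θ‖ = 1 := by
  rw [expo, show Complex.I * n * θ = ((n * θ : ℝ) : ℂ) * Complex.I by push_cast; ring,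
    Complex.norm_exp_ofReal_mul_I]

lemma expo_neg_mul_self (n : ℤ) (θ : ℝ) : expo (-n) θ * expo n θ = 1 := by
  rw [← expo_add, neg_add_cancel, expo_zero]

lemma expo_add_two_pi (n : ℤ) (θ : ℝ) : expo n (θ + 2 * Real.pi) = expo n θ := by
  rw [expo, expo, Complex.exp_eq_exp_iff_exists_int]
  exact ⟨n, by push_cast; ring⟩

lemma hasDerivAt_expo (n : ℤ) (θ : ℝ) : HasDerivAt (expo n) (Complex.I * n * expo n θ) θ := by
  have h1 : HasDerivAt (fun t : ℝ => Complex.I * n * (t : ℂ)) (Complex.I * n * 1) θ :=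
    (Complex.ofRealCLM.hasDerivAt (x := θ)).const_mul _
  have h2 := h1.cexp
  rw [mul_one, mul_comm (Complex.exp _)] at h2
  exact h2

lemma continuous_expo (n : ℤ) : Continuous (expo n) :=
  continuous_iff_continuousAt.2 fun θ => (hasDerivAt_expo n θ).continuousAt

lemma fourierC_mul_expo (f : ℝ → ℂ) (n m : ℤ) :
    fourierC (fun θ => f θ * expo n θ) m = fourierC f (m - n) := by
  simp only [fourierC]
  congr 2
  funext θ
  rw [mul_assoc, ← expo_add]
  congr 2
  ring

lemma fourierC_const_mul (c : ℂ) (f : ℝ → ℂ) (m : ℤ) :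
    fourierC (fun θ => c * f θ) m = c * fourierC f m := by
  simp only [fourierC, mul_assoc, intervalIntegral.integral_const_mul]
  ring

lemma fourierC_add {f g : ℝ → ℂ} (hf : Continuous f) (hg : Continuous g) (m : ℤ) :
    fourierC (fun θ => f θ + g θ) m = fourierC f m + fourierC g m := by
  simp only [fourierC, add_mul]
  rw [intervalIntegral.integral_add, mul_add]
  · exact (hf.mul (continuous_expo _)).intervalIntegrable _ _
  · exact (hg.mul (continuous_expo _)).intervalIntegrable _ _

lemma fourierC_comp_neg (f : ℝ → ℂ) (m : ℤ) :
    fourierC (fun θ => f (-θ)) m = fourierC f (-m) := by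
  simp only [fourierC]
  congr 1
  have h := intervalIntegral.integral_comp_neg (a := -Real.pi) (b := Real.pi)
    (fun θ => f θ * expo (- -m) θ)
  rw [neg_neg (Real.pi)] at h
  rw [neg_neg] at h ⊢
  rw [← h]
  refine intervalIntegral.integral_congr fun θ _ => ?_
  simp only [expo_neg_right]

lemma norm_fourierC_le {f : ℝ → ℂ} {C : ℝ} (hC : ∀ θ, ‖f θ‖ ≤ C) (m : ℤ) :
    ‖fourierC f m‖ ≤ C := by
  have h1 : ‖∫ θ in (-Real.pi)..Real.pi, f θ * expo (-m) θ‖ ≤ C * |Real.pi - -Real.pi| := by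
    refine intervalIntegral.norm_integral_le_of_norm_le_const fun θ _ => ?_
    rw [norm_mul, norm_expo, mul_one]
    exact hC θ
  have hπ := Real.pi_pos
  rw [sub_neg_eq_add, abs_of_pos (by positivity)] at h1
  rw [fourierC, norm_mul]
  have h2 : ‖(1 / (2 * (Real.pi : ℂ)))‖ = 1 / (2 * Real.pi) := by
    simp [abs_of_pos hπ]
  rw [h2, one_div, inv_mul_le_iff₀ (by positivity)]
  linarith

lemma fourierC_expo (n m : ℤ) : fourierC (expo n) m = if m = n then 1 else 0 := by
  have hπ : (Real.pi : ℂ) ≠ 0 := by exact_mod_cast Real.pi_ne_zero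
  have h0 : ∀ k : ℤ, fourierC (fun _ => 1) k = if k = 0 then 1 else 0 := by
    intro k
    split_ifs with hk
    · subst hk
      simp only [fourierC, neg_zero, expo_zero, mul_one, intervalIntegral.integral_const,
        sub_neg_eq_add]
      rw [Complex.real_smul]
      push_cast
      field_simp
      ring
    · have hk' : (Complex.I * ((-k : ℤ) : ℂ)) ≠ 0 := by simp [hk]
      have h1 := intervalIntegral.integral_eq_sub_of_hasDerivAt (a := -Real.pi) (b := Real.pi)
        (fun θ _ => hasDerivAt_expo (-k) θ)
        ((continuous_const.mul (continuous_expo (-k))).intervalIntegrable _ _)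
      rw [intervalIntegral.integral_const_mul] at h1
      have h2 := expo_add_two_pi (-k) (-Real.pi)
      rw [show -Real.pi + 2 * Real.pi = Real.pi by ring] at h2
      rw [h2, sub_self] at h1
      have h3 := (mul_eq_zero.1 h1).resolve_left hk'
      simp only [fourierC, one_mul, h3, mul_zero]
  have h1 := fourierC_mul_expo (fun _ => 1) n m
  simp only [one_mul] at h1
  rw [show (fun θ => expo n θ) = expo n from rfl] at h1
  rw [h1, h0]
  simp [sub_eq_zero]

/-- Fourier coefficients of a uniformly convergent series of continuous functions. -/
lemma hasSum_fourierC_tsum {f : ℤ → ℝ → ℂ} {u : ℤ → ℝ} (hu : Summable u)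
    (hf : ∀ k, Continuous (f k)) (hb : ∀ k θ, ‖f k θ‖ ≤ u k) (m : ℤ) :
    HasSum (fun k => fourierC (f k) m) (fourierC (fun θ => ∑' k, f k θ) m) := by
  have h1 := intervalIntegral.hasSum_intervalIntegral_of_summable_norm
    (a := -Real.pi) (b := Real.pi)
    (f := fun k : ℤ => (⟨fun θ => f k θ * expo (-m) θ,
      (hf k).mul (continuous_expo (-m))⟩ : C(ℝ, ℂ))) ?_
  · have h2 := h1.mul_left (1 / (2 * (Real.pi : ℂ)))
    simp only [ContinuousMap.coe_mk, tsum_mul_right] at h2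
    exact h2
  · refine Summable.of_nonneg_of_le (fun k => norm_nonneg _) (fun k => ?_) hu
    rw [ContinuousMap.norm_le _ ((norm_nonneg _).trans (hb k 0))]
    rintro ⟨θ, hθ⟩
    simpa using hb k θ

/-- Fourier coefficients of an absolutely convergent trigonometric series. -/
lemma fourierC_tsum {c : ℤ → ℂ} (hc : Summable fun k => ‖c k‖) (m : ℤ) :
    fourierC (fun θ => ∑' k, c k * expo k θ) m = c m := by
  refine (hasSum_fourierC_tsum hc (fun k => continuous_const.mul (continuous_expo k))
    (fun k θ => by simp) m).unique ?_
  convert hasSum_ite_eq m (c m) using 2 with k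
  refine (fourierC_const_mul (c k) (expo k) m).trans ?_
  rw [fourierC_expo]
  by_cases h : m = k
  · simp [h]
  · simp [h, Ne.symm h]

/-- Fourier inversion for a continuous periodic function with summable coefficients. -/
lemma hasSum_fourierC {f : ℝ → ℂ} (hf : Continuous f) (hper : ∀ θ, f (θ + 2 * Real.pi) = f θ)
    (hs : Summable fun k => ‖fourierC f k‖) (θ : ℝ) :
    HasSum (fun k => fourierC f k * expo k θ) (f θ) := by
  -- Pass to the circle `AddCircle (2π)`, where the coefficients and exponentials are the standard
  -- ones.
  have : Fact (0 < 2 * Real.pi) := ⟨Real.two_pi_pos⟩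
  let g : C(AddCircle (2 * Real.pi), ℂ) :=
    ⟨Function.Periodic.lift hper, continuous_coinduced_dom.2 hf⟩
  have hg : ∀ t : ℝ, g t = f t := fun t => rfl
  have hexp : ∀ (k : ℤ) (t : ℝ), fourier k (t : AddCircle (2 * Real.pi)) = expo k t := by
    intro k t
    rw [fourier_coe_apply, expo]
    have hπ : (Real.pi : ℂ) ≠ 0 := by exact_mod_cast Real.pi_ne_zero
    congr 1
    push_cast
    field_simp
  have hcoeff : ∀ k, fourierCoeff g k = fourierC f k := by
    intro k
    rw [fourierCoeff_eq_intervalIntegral _ k (-Real.pi), fourierC,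
      show -Real.pi + 2 * Real.pi = Real.pi by ring, Complex.real_smul]
    push_cast
    congr 1
    refine intervalIntegral.integral_congr fun t _ => ?_
    simp only [hexp, hg, smul_eq_mul, mul_comm]
  have h1 := has_pointwise_sum_fourier_series_of_summable (f := g)
    (by rw [show fourierCoeff g = fourierC f from funext hcoeff]; exact hs.of_norm) (θ : AddCircle (2 * Real.pi))
  simpa only [hcoeff, hexp, hg, smul_eq_mul] using h1

lemma fourierC_deriv {f f' : ℝ → ℂ} (hf : ∀ θ, HasDerivAt f (f' θ) θ) (hf' : Continuous f')
    (hper : ∀ θ, f (θ + 2 * Real.pi) = f θ) (k : ℤ) :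
    fourierC f' k = Complex.I * k * fourierC f k := by
  have hc : Continuous f := continuous_iff_continuousAt.2 fun θ => (hf θ).continuousAt
  have h1 := intervalIntegral.integral_mul_deriv_eq_deriv_mul (a := -Real.pi) (b := Real.pi)
    (fun θ _ => hasDerivAt_expo (-k) θ) (fun θ _ => hf θ)
    ((continuous_const.mul (continuous_expo (-k))).intervalIntegrable _ _)
    (hf'.intervalIntegrable _ _)
  have h2 := expo_add_two_pi (-k) (-Real.pi)
  have h3 := hper (-Real.pi)
  rw [show -Real.pi + 2 * Real.pi = Real.pi by ring] at h2 h3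
  rw [h2, h3, sub_self, zero_sub] at h1
  have h4 : ∫ θ in (-Real.pi)..Real.pi, f' θ * expo (-k) θ =
      Complex.I * k * ∫ θ in (-Real.pi)..Real.pi, f θ * expo (-k) θ := by
    have h5 : ∀ θ, f' θ * expo (-k) θ = expo (-k) θ * f' θ := fun θ => mul_comm _ _
    simp only [h5]
    rw [h1, ← intervalIntegral.integral_neg, ← intervalIntegral.integral_const_mul]
    refine intervalIntegral.integral_congr fun θ _ => ?_
    push_cast
    ring
  simp only [fourierC, h4]
  ring

/-! ### Fourier coefficients of symbols -/

lemma IsPeriodicSym.continuous {α : ℝ} {f : ℝ → ℝ → ℂ} (hf : IsPeriodicSym α f) :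
    Continuous (fun p : ℝ × ℝ => f p.1 p.2) :=
  (hf.sym 1).continuous

lemma IsPeriodicSym.continuous_fst {α : ℝ} {f : ℝ → ℝ → ℂ} (hf : IsPeriodicSym α f) (ξ : ℝ) :
    Continuous (fun θ => f θ ξ) :=
  hf.continuous.comp (by fun_prop : Continuous fun θ : ℝ => (θ, ξ))

lemma IsPeriodicSym.exists_bound {α : ℝ} {f : ℝ → ℝ → ℂ} (hf : IsPeriodicSym α f) :
    ∃ C, ∀ θ ξ, ‖f θ ξ‖ ≤ C * (1 + |ξ|) ^ α := by
  obtain ⟨C, hC⟩ := (hf.sym 0).bound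
  exact ⟨C, fun θ ξ => by simpa using hC () θ ξ⟩

/-- Integration by parts: `(1 + |k|) ‖f̂(k)‖` is the sum of the sizes of the `k`-th coefficients of
`f` and `∂_θ f`, and `∂_θ f` has the same order as `f`. -/
lemma IsPeriodicSym.fourierC_bound_pow {α : ℝ} {f : ℝ → ℝ → ℂ} (hf : IsPeriodicSym α f) (M : ℕ) :
    ∃ C, ∀ (k : ℤ) (ξ : ℝ),
      (1 + |(k : ℝ)|) ^ M * ‖fourierC (fun θ => f θ ξ) k‖ ≤ C * (1 + |ξ|) ^ α := by
  induction M generalizing f with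
  | zero =>
    obtain ⟨C, hC⟩ := hf.exists_bound
    exact ⟨C, fun k ξ => by simpa using norm_fourierC_le (fun θ => hC θ ξ) k⟩
  | succ M ih =>
    obtain ⟨g, -, hg, -, sg, -⟩ := hf.exists_partials
    obtain ⟨C, hC⟩ := ih hf
    obtain ⟨D, hD⟩ := ih sg
    refine ⟨C + D, fun k ξ => ?_⟩
    have h1 := fourierC_deriv (fun θ => hg θ ξ) (sg.continuous_fst ξ)
      (fun θ => hf.periodic θ ξ) k
    have h2 : ‖fourierC (fun θ => g θ ξ) k‖ = |(k : ℝ)| * ‖fourierC (fun θ => f θ ξ) k‖ := by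
      rw [h1]; simp
    calc _ = (1 + |(k : ℝ)|) ^ M * ‖fourierC (fun θ => f θ ξ) k‖ +
          (1 + |(k : ℝ)|) ^ M * ‖fourierC (fun θ => g θ ξ) k‖ := by rw [h2]; ring
      _ ≤ _ := add_le_add (hC k ξ) (hD k ξ)
      _ = _ := by ring

lemma IsPeriodicSym.fourierC_symBound {α : ℝ} {f : ℝ → ℝ → ℂ} (hf : IsPeriodicSym α f) (L : ℝ) :
    SymBound (fun k : ℤ => (1 + |(k : ℝ)|) ^ (-L)) α
      (fun k _ ξ => fourierC (fun θ => f θ ξ) k) := by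
  obtain ⟨M, hM⟩ := exists_nat_ge L
  obtain ⟨C, hC⟩ := hf.fourierC_bound_pow M
  refine ⟨C, fun k _ ξ => ?_⟩
  have h0 := one_add_abs_pos (k : ℝ)
  have h1 : (1 + |(k : ℝ)|) ^ L ≤ (1 + |(k : ℝ)|) ^ M := by
    rw [← Real.rpow_natCast]
    exact one_add_abs_rpow_le_of_le hM _
  have h2 := (mul_le_mul_of_nonneg_right h1 (norm_nonneg _)).trans (hC k ξ)
  beta_reduce
  rw [Real.rpow_neg h0.le, mul_right_comm, ← div_eq_mul_inv,
    le_div_iff₀ (Real.rpow_pos_of_pos h0 L), mul_comm]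
  exact h2

/-- Differentiation under the integral sign, with domination on a unit ball around `ξ` by Peetre's
inequality. -/
lemma IsPeriodicSym.hasDerivAt_fourierC {α β : ℝ} {f h : ℝ → ℝ → ℂ} (hf : IsPeriodicSym α f)
    (hh : ∀ θ ξ, HasDerivAt (fun x => f θ x) (h θ ξ) ξ) (sh : IsPeriodicSym β h)
    (k : ℤ) (ξ : ℝ) :
    HasDerivAt (fun x => fourierC (fun θ => f θ x) k) (fourierC (fun θ => h θ ξ) k) ξ := by
  obtain ⟨C, hC⟩ := sh.exists_bound
  have h1 := intervalIntegral.hasDerivAt_integral_of_dominated_loc_of_deriv_le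
    (μ := MeasureTheory.volume) (a := -Real.pi) (b := Real.pi)
    (F := fun x θ => f θ x * expo (-k) θ) (F' := fun x θ => h θ x * expo (-k) θ) (x₀ := ξ)
    (s := Metric.ball ξ 1) (bound := fun _ => |C| * (2 ^ |β| * (1 + |ξ|) ^ β))
    (Metric.ball_mem_nhds ξ one_pos)
    (Filter.Eventually.of_forall fun x =>
      ((hf.continuous_fst x).mul (continuous_expo _)).aestronglyMeasurable)
    (((hf.continuous_fst ξ).mul (continuous_expo _)).intervalIntegrable _ _)
    ((sh.continuous_fst ξ).mul (continuous_expo _)).aestronglyMeasurable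
    (Filter.Eventually.of_forall fun θ _ x hx => ?_)
    (continuous_const.intervalIntegrable _ _)
    (Filter.Eventually.of_forall fun θ _ x _ => (hh θ x).mul_const _)
  · exact h1.2.const_mul _
  · rw [norm_mul, norm_expo, mul_one]
    have h1 := peetre β ξ (x - ξ)
    rw [add_sub_cancel] at h1
    have h2 : (1 + |x - ξ|) ^ |β| ≤ 2 ^ |β| := by
      refine Real.rpow_le_rpow (one_add_abs_pos _).le ?_ (abs_nonneg _)
      rw [Metric.mem_ball, Real.dist_eq] at hx
      linarith
    exact (hC θ x).trans (mul_le_mul (le_abs_self _) (h1.trans (mul_le_mul_of_nonneg_right h2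
      (Real.rpow_nonneg (one_add_abs_pos _).le _)))
      (Real.rpow_nonneg (one_add_abs_pos _).le _) (abs_nonneg _))

/-- The Fourier coefficients of a symbol are rapidly decreasing, as symbols in `ξ`. -/
lemma IsPeriodicSym.fourierC_sym {α : ℝ} {f : ℝ → ℝ → ℂ} (hf : IsPeriodicSym α f) (L : ℝ)
    (N : ℕ) :
    Sym (fun k : ℤ => (1 + |(k : ℝ)|) ^ (-L)) N α
      (fun k _ ξ => fourierC (fun θ => f θ ξ) k) := by
  induction N generalizing α f with
  | zero => exact hf.fourierC_symBound L
  | succ N ih =>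
    obtain ⟨g, h, -, hh, -, sh⟩ := hf.exists_partials
    exact ⟨hf.fourierC_symBound L, fun _ _ _ => 0, fun k _ ξ => fourierC (fun θ => h θ ξ) k,
      fun k θ ξ => hasDerivAt_const _ _, fun k _ ξ => hf.hasDerivAt_fourierC hh sh k ξ,
      sym_zero _ _ _, ih sh⟩

/-- The exponentials, as a family of symbols. -/
lemma sym_expo (N : ℕ) {L : ℝ} (hL : N ≤ L) :
    Sym (fun k : ℤ => (1 + |(k : ℝ)|) ^ L) N 0 (fun k θ _ => expo k θ) := by
  have hbd : ∀ {L : ℝ}, 0 ≤ L →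
      SymBound (fun k : ℤ => (1 + |(k : ℝ)|) ^ L) 0 (fun k θ _ => expo k θ) := by
    intro L hL
    refine ⟨1, fun k θ ξ => ?_⟩
    rw [norm_expo, Real.rpow_zero, one_mul, mul_one]
    exact Real.one_le_rpow (by linarith [abs_nonneg (k : ℝ)]) hL
  induction N generalizing L with
  | zero => exact hbd (by simpa using hL)
  | succ N ih =>
    push_cast at hL
    have hN : (0 : ℝ) ≤ N := N.cast_nonneg
    refine ⟨hbd (by linarith), fun k θ _ => Complex.I * k * expo k θ, fun _ _ _ => 0,
      fun k θ _ => hasDerivAt_expo k θ, fun _ _ _ => hasDerivAt_const _ _, ?_, ?_⟩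
    · have h1 := sym_const (fun k : ℤ => Complex.I * k) N le_rfl
        (w := fun k : ℤ => (1 + |(k : ℝ)|) ^ (1 : ℝ)) (fun k => by simp)
      have h2 := h1.mul (ih (L := L - 1) (by linarith))
      simp only [← Real.rpow_add (one_add_abs_pos _), add_sub_cancel, add_zero] at h2
      exact h2
    · exact sym_zero _ _ _

lemma summable_one_add_abs_rpow {L : ℝ} (hL : 2 ≤ L) :
    Summable fun k : ℤ => (1 + |(k : ℝ)|) ^ (-L) := by
  have h2 : Summable fun k : ℤ => (1 + |(k : ℝ)|) ^ (-2 : ℝ) := by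
    have hn : Summable fun n : ℕ => (1 + (n : ℝ)) ^ (-2 : ℝ) := by
      have h1 := (summable_nat_add_iff 1).2 (Real.summable_nat_rpow.2 (by norm_num : (-2 : ℝ) < -1))
      refine h1.congr fun n => ?_
      push_cast
      rw [add_comm]
    refine Summable.of_nat_of_neg ?_ ?_
    · simpa using hn
    · simpa using hn
  exact Summable.of_nonneg_of_le (fun k => Real.rpow_nonneg (one_add_abs_pos _).le _)
    (fun k => one_add_abs_rpow_le_of_le (by linarith) _) h2

lemma IsPeriodicSym.summable_fourierC {α : ℝ} {f : ℝ → ℝ → ℂ} (hf : IsPeriodicSym α f) (ξ : ℝ) :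
    Summable fun k => ‖fourierC (fun θ => f θ ξ) k‖ := by
  obtain ⟨C, hC⟩ := hf.fourierC_symBound 2
  exact Summable.of_nonneg_of_le (fun k => norm_nonneg _) (fun k => hC k 0 ξ)
    (((summable_one_add_abs_rpow le_rfl).mul_left C).mul_right _)

lemma IsPeriodicSym.hasSum_fourierC {α : ℝ} {f : ℝ → ℝ → ℂ} (hf : IsPeriodicSym α f) (θ ξ : ℝ) :
    HasSum (fun k => fourierC (fun t => f t ξ) k * expo k θ) (f θ ξ) :=
  ArcPDO.hasSum_fourierC (hf.continuous_fst ξ) (fun θ => hf.periodic θ ξ)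
    (hf.summable_fourierC ξ) θ

/-! ### Composition of periodic pseudo-differential operators -/

lemma Op_fourierC_expo (τ : ℝ → ℤ → ℂ) (n : ℤ) (θ : ℝ) :
    Op τ (fourierC (expo n)) θ = τ θ n * expo n θ := by
  rw [Op, tsum_eq_single n]
  · simp [fourierC_expo]
  · intro m hm
    simp [fourierC_expo, hm]

/-- Expand `τ(·, n) e_n` in Fourier series and index the frequencies as `n + k`; the factor `e_n`
cancels its conjugate. -/
lemma compSymbol_eq_tsum (σ τ : ℝ → ℤ → ℂ) (θ : ℝ) (n : ℤ) :
    compSymbol σ τ θ n =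
      ∑' k : ℤ, σ θ (n + k) * (fourierC (fun t => τ t n) k * expo k θ) := by
  have h1 : Op τ (fourierC (expo n)) = fun θ => τ θ n * expo n θ :=
    funext (Op_fourierC_expo τ n)
  rw [compSymbol, h1, Op, conj_expo, ← tsum_mul_left, ← (Equiv.addLeft n).tsum_eq]
  refine tsum_congr fun k => ?_
  simp only [Equiv.coe_addLeft, fourierC_mul_expo, add_sub_cancel_left, expo_add]
  linear_combination (σ θ (n + k) * fourierC (fun t => τ t n) k * expo k θ) *
    expo_neg_mul_self n θ

/-- The composite `∑_k σ(θ, ξ + k) τ̂(k, ξ) e_k(θ)` of two prolongated symbols. -/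
def compProlong (σ τ : ℝ → ℝ → ℂ) (θ ξ : ℝ) : ℂ :=
  ∑' k : ℤ, σ θ (ξ + k) * (fourierC (fun t => τ t ξ) k * expo k θ)

section

variable {α β : ℝ} {σ τ : ℝ → ℝ → ℂ}

/-- The coefficients are taken with decay `L + N`, so that decay `L` is left after paying for up to
`N` derivatives of `e_k`. -/
lemma IsPeriodicSym.fourierC_mul_expo_sym (hτ : IsPeriodicSym β τ) (L : ℝ) (N : ℕ) :
    Sym (fun k : ℤ => (1 + |(k : ℝ)|) ^ (-L)) N β
      (fun k θ ξ => fourierC (fun t => τ t ξ) k * expo k θ) := by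
  have h1 := (hτ.fourierC_sym (L + N) N).mul (sym_expo N le_rfl)
  simpa only [← Real.rpow_add (one_add_abs_pos _), add_zero, neg_add_rev,
    neg_add_cancel_comm] using h1

/-- Rapid decay of `τ̂(k, ·)` absorbs a polynomial weight of any degree, and the remaining exponent
`-2` is summable over `ℤ`. -/
lemma Sym.mul_fourierC {N : ℕ} {L : ℝ} {f : ℤ → ℝ → ℝ → ℂ}
    (hf : Sym (fun k : ℤ => (1 + |(k : ℝ)|) ^ L) N α f) (hτ : IsPeriodicSym β τ) :
    Sym (fun k : ℤ => (1 + |(k : ℝ)|) ^ (-2 : ℝ)) N (α + β)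
      (fun k θ ξ => f k θ ξ * (fourierC (fun t => τ t ξ) k * expo k θ)) := by
  have h1 := hf.mul (hτ.fourierC_mul_expo_sym (L + 2) N)
  simpa only [← Real.rpow_add (one_add_abs_pos _), show L + -(L + 2) = -2 by ring] using h1

lemma IsPeriodicSym.compProlong (hσ : IsPeriodicSym α σ) (hτ : IsPeriodicSym β τ) :
    IsPeriodicSym (α + β) (compProlong σ τ) := by
  refine ⟨fun N => ?_, fun θ ξ => ?_⟩
  · exact (((hσ.sym N).shift le_rfl).mul_fourierC hτ).tsum (summable_one_add_abs_rpow le_rfl)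
  · simp only [ArcPDO.compProlong, hσ.periodic, expo_add_two_pi]

/-- By Fourier inversion `σ τ` is the same series with `σ(θ, ξ + k)` replaced by `σ(θ, ξ)`. The
difference involves only `σ(θ, ξ + k) - σ(θ, ξ)`, of order `α - 1`. -/
lemma IsPeriodicSym.compProlong_sub_mul (hσ : IsPeriodicSym α σ) (hτ : IsPeriodicSym β τ) :
    IsPeriodicSym (α + β - 1) (fun θ ξ => ArcPDO.compProlong σ τ θ ξ - σ θ ξ * τ θ ξ) := by
  refine ⟨fun N => ?_, fun θ ξ => ?_⟩
  · have h1 := ((((hσ.sym (N + 1)).shift_sub le_rfl).mul_fourierC hτ).tsum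
      (summable_one_add_abs_rpow le_rfl))
    rw [show α - 1 + β = α + β - 1 by ring] at h1
    convert h1 using 4 with _ θ ξ
    have h2 := (((hσ.sym 0).shift le_rfl).mul_fourierC hτ).bound.summable
      (summable_one_add_abs_rpow le_rfl) θ ξ
    have h3 := (hτ.hasSum_fourierC θ ξ).mul_left (σ θ ξ)
    simp only [sub_mul]
    exact (h2.hasSum.sub h3).tsum_eq.symm
  · have h1 := (hσ.compProlong hτ).periodic θ ξ
    simp only [h1, hσ.periodic, hτ.periodic]

lemma IsPeriodicSym.add {f g : ℝ → ℝ → ℂ} (hf : IsPeriodicSym α f) (hg : IsPeriodicSym α g) :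
    IsPeriodicSym α (fun θ ξ => f θ ξ + g θ ξ) :=
  ⟨fun N => (hf.sym N).add (hg.sym N), fun θ ξ => by simp only [hf.periodic, hg.periodic]⟩

lemma IsPeriodicSym.const_mul {f : ℝ → ℝ → ℂ} (hf : IsPeriodicSym α f) (c : ℂ) :
    IsPeriodicSym α (fun θ ξ => c * f θ ξ) := by
  refine ⟨fun N => ?_, fun θ ξ => by simp only [hf.periodic]⟩
  have h1 := (sym_const (fun _ : Unit => c) N le_rfl (w := fun _ => ‖c‖) (fun _ => le_rfl)).mul
    (hf.sym N)
  simp only [zero_add, mul_one] at h1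
  clear hf
  -- A constant weight can be moved into the constant of each estimate, at every level of the
  -- recursion.
  have key : ∀ {N : ℕ} {α : ℝ} {g : Unit → ℝ → ℝ → ℂ}, Sym (fun _ : Unit => ‖c‖) N α g →
      Sym (fun _ : Unit => 1) N α g := by
    have h0 : ∀ {α : ℝ} {g : Unit → ℝ → ℝ → ℂ}, SymBound (fun _ : Unit => ‖c‖) α g →
        SymBound (fun _ : Unit => 1) α g := by
      rintro α g ⟨C, hC⟩
      exact ⟨C * ‖c‖, fun k θ ξ => by simpa using hC k θ ξ⟩
    intro N
    induction N with
    | zero => exact h0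
    | succ N ih =>
      rintro α g ⟨hb, g₁, g₂, h₁, h₂, s₁, s₂⟩
      exact ⟨h0 hb, g₁, g₂, h₁, h₂, ih s₁, ih s₂⟩
  exact key h1

lemma IsPeriodicSym.comp_neg {f : ℝ → ℝ → ℂ} (hf : IsPeriodicSym α f) :
    IsPeriodicSym α (fun θ ξ => f (-θ) (-ξ)) := by
  refine ⟨fun N => ?_, fun θ ξ => ?_⟩
  · induction N generalizing α f with
    | zero =>
      obtain ⟨C, hC⟩ := hf.exists_bound
      exact ⟨C, fun _ θ ξ => by simpa using hC (-θ) (-ξ)⟩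
    | succ N ih =>
      obtain ⟨C, hC⟩ := hf.exists_bound
      obtain ⟨g, h, hg, hh, sg, sh⟩ := hf.exists_partials
      refine ⟨⟨C, fun _ θ ξ => by simpa using hC (-θ) (-ξ)⟩, fun _ θ ξ => -1 * g (-θ) (-ξ),
        fun _ θ ξ => -1 * h (-θ) (-ξ), fun _ θ ξ => ?_, fun _ θ ξ => ?_,
        ih (sg.const_mul (-1)), ih (sh.const_mul (-1))⟩
      · simpa using! HasDerivAt.scomp θ (hg (-θ) (-ξ)) (hasDerivAt_neg θ)
      · simpa using! HasDerivAt.scomp ξ (hh (-θ) (-ξ)) (hasDerivAt_neg ξ)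
  · have h1 := hf.periodic (-(θ + 2 * Real.pi)) (-ξ)
    rw [← h1]
    congr 1
    ring

end

section

variable {α β : ℝ} {σ τ : ℝ → ℤ → ℂ}

lemma compSymbol_mem_symbolClass (hσ : σ ∈ symbolClass α) (hτ : τ ∈ symbolClass β) :
    compSymbol σ τ ∈ symbolClass (α + β) := by
  rw [mem_symbolClass_iff] at hσ hτ ⊢
  obtain ⟨s, hs, es⟩ := hσ
  obtain ⟨t, ht, et⟩ := hτ
  refine ⟨compProlong s t, hs.compProlong ht, fun θ n => ?_⟩
  rw [compSymbol_eq_tsum]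
  simp only [es, et, compProlong, Int.cast_add]

/-- Both composites have the same leading part `σ τ`, since scalar symbols commute; only the two
remainders of order `α + β - 1` survive. -/
lemma compSymbol_commutator_mem_symbolClass (hσ : σ ∈ symbolClass α) (hτ : τ ∈ symbolClass β) :
    (fun θ n => compSymbol σ τ θ n - compSymbol τ σ θ n) ∈ symbolClass (α + β - 1) := by
  rw [mem_symbolClass_iff] at hσ hτ ⊢
  obtain ⟨s, hs, es⟩ := hσ
  obtain ⟨t, ht, et⟩ := hτ
  have h1 := hs.compProlong_sub_mul ht
  have h2 := (ht.compProlong_sub_mul hs).const_mul (-1)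
  rw [add_comm β α] at h2
  refine ⟨_, h1.add h2, fun θ n => ?_⟩
  rw [compSymbol_eq_tsum, compSymbol_eq_tsum]
  simp only [es, et, compProlong, Int.cast_add]
  ring

/-- Symbols of operators that preserve parity: `σ(-θ, -n) = σ(θ, n)`. -/
def IsSymmetricSymbol (σ : ℝ → ℤ → ℂ) : Prop := ∀ θ n, σ (-θ) (-n) = σ θ n

lemma IsSymmetricSymbol.compSymbol (hσ : IsSymmetricSymbol σ) (hτ : IsSymmetricSymbol τ) :
    IsSymmetricSymbol (compSymbol σ τ) := by
  intro θ n
  rw [compSymbol_eq_tsum, compSymbol_eq_tsum, ← (Equiv.neg ℤ).tsum_eq]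
  refine tsum_congr fun k => ?_
  have h1 : fourierC (fun t => τ t (-n)) (-k) = fourierC (fun t => τ t n) k := by
    rw [← fourierC_comp_neg]
    simp only [hτ _ n]
  rw [Equiv.neg_apply, h1, expo_neg_right, neg_neg, ← neg_add, hσ]

lemma symmetrize_eq (hσ : IsSymmetricSymbol σ) : symmetrize σ = σ := by
  funext θ n
  rw [symmetrize, hσ]
  ring

lemma isSymmetricSymbol_symmetrize (σ : ℝ → ℤ → ℂ) : IsSymmetricSymbol (symmetrize σ) := by
  intro θ n
  simp only [symmetrize, neg_neg]
  ring

lemma symmetrize_mem_symbolClass (hσ : σ ∈ symbolClass α) : symmetrize σ ∈ symbolClass α := by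
  rw [mem_symbolClass_iff] at hσ ⊢
  obtain ⟨s, hs, es⟩ := hσ
  refine ⟨_, (hs.add hs.comp_neg).const_mul (1 / 2), fun θ n => ?_⟩
  simp only [symmetrize, es]
  push_cast
  ring

lemma isSymmetricSymbol_tildeSymbol (a₁ a₂ : ℝ → ℕ → ℂ) :
    IsSymmetricSymbol (tildeSymbol a₁ a₂) := by
  intro θ n
  simp only [tildeSymbol, Real.cos_neg, Real.sin_neg, Int.natAbs_neg, Int.sign_neg]
  push_cast
  ring

/-! ### Action on smooth functions -/

/-- Rapidly decreasing coefficients. -/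
def IsRapid (c : ℤ → ℂ) : Prop :=
  ∀ L : ℝ, ∃ C : ℝ, ∀ k : ℤ, ‖c k‖ ≤ C * (1 + |(k : ℝ)|) ^ (-L)

/-- Treating a function of `θ` alone as a symbol of order `0` lets the summation result for symbols
prove smoothness of Fourier-type series. -/
lemma Sym.freeze {ι : Type*} {w : ι → ℝ} {N : ℕ} {α : ℝ} {f : ι → ℝ → ℝ → ℂ}
    (hf : Sym w N α f) (ξ₀ : ℝ) : Sym w N 0 (fun k θ _ => f k θ ξ₀) := by
  have h0 : ∀ {f : ι → ℝ → ℝ → ℂ}, SymBound w α f → SymBound w 0 (fun k θ _ => f k θ ξ₀) := by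
    rintro f ⟨C, hC⟩
    refine ⟨C * (1 + |ξ₀|) ^ α, fun k θ ξ => ?_⟩
    rw [Real.rpow_zero, mul_one, mul_right_comm]
    exact hC k θ ξ₀
  induction N generalizing f with
  | zero => exact h0 hf
  | succ N ih =>
    obtain ⟨hb, g, h, hg, -, sg, -⟩ := hf
    exact ⟨h0 hb, fun k θ _ => g k θ ξ₀, fun _ _ _ => 0, fun k θ _ => hg k θ ξ₀,
      fun _ _ _ => hasDerivAt_const _ _, ih sg, sym_zero _ _ _⟩

/-- Operators map smooth functions to smooth ones: the values `σ(θ, k)` are the shifted family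
frozen at `ξ = 0`, which grows polynomially in `k`, as do the derivatives of `e_k`, and `c` beats
both. -/
lemma isPeriodicSym_Op (hσ : σ ∈ symbolClass α) {c : ℤ → ℂ} (hc : IsRapid c) :
    IsPeriodicSym 0 (fun θ _ => Op σ c θ) := by
  rw [mem_symbolClass_iff] at hσ
  obtain ⟨s, hs, es⟩ := hσ
  refine ⟨fun N => ?_, fun θ ξ => ?_⟩
  · have h1 := ((hs.sym N).shift le_rfl).freeze 0
    obtain ⟨C, hC⟩ := hc (|α| + N + N + 2)
    have h2 := sym_const c N (le_refl 0) (w := fun k => C * (1 + |(k : ℝ)|) ^ (-(|α| + N + N + 2)))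
      hC
    have h3 := (h1.mul h2).mul (sym_expo N le_rfl)
    have h4 : Summable fun k : ℤ => (1 + |(k : ℝ)|) ^ (|α| + N) *
        (C * (1 + |(k : ℝ)|) ^ (-(|α| + N + N + 2))) * (1 + |(k : ℝ)|) ^ (N : ℝ) := by
      refine ((summable_one_add_abs_rpow le_rfl).mul_left C).congr fun k => ?_
      have h5 : (1 + |(k : ℝ)|) ^ (-2 : ℝ) = (1 + |(k : ℝ)|) ^ (|α| + N) *
          (1 + |(k : ℝ)|) ^ (-(|α| + N + N + 2)) * (1 + |(k : ℝ)|) ^ (N : ℝ) := by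
        rw [← Real.rpow_add (one_add_abs_pos _), ← Real.rpow_add (one_add_abs_pos _)]
        congr 1
        ring
      rw [h5]
      ring
    have h6 := h3.tsum h4
    simpa only [add_zero, zero_add, Op, es] using h6
  · simp only [Op, es, hs.periodic, expo_add_two_pi]

lemma isRapid_fourierC {f : ℝ → ℂ} {α : ℝ} (hf : IsPeriodicSym α (fun θ _ => f θ)) :
    IsRapid (fourierC f) := by
  intro L
  obtain ⟨C, hC⟩ := hf.fourierC_symBound L
  exact ⟨C, fun k => by simpa using hC k 0 0⟩

lemma hasSum_fourierC_Op (hσ : σ ∈ symbolClass α) {c : ℤ → ℂ} (hc : IsRapid c) (m : ℤ) :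
    HasSum (fun n => c n * fourierC (fun θ => σ θ n * expo n θ) m) (fourierC (Op σ c) m) := by
  rw [mem_symbolClass_iff] at hσ
  obtain ⟨s, hs, es⟩ := hσ
  obtain ⟨C, hC⟩ := hs.exists_bound
  obtain ⟨D, hD⟩ := hc (α + 2)
  have h1 := hasSum_fourierC_tsum (f := fun n θ => σ θ n * c n * expo n θ)
    (u := fun n => |C| * D * (1 + |(n : ℝ)|) ^ (-2 : ℝ))
    ((summable_one_add_abs_rpow le_rfl).mul_left _) (fun n => ?_) (fun n θ => ?_) m
  · convert h1 using 2 with n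
    · rw [← fourierC_const_mul]
      congr 1
      funext θ
      ring
    · rfl
  · simp only [es]
    exact ((hs.continuous_fst n).mul continuous_const).mul (continuous_expo n)
  · rw [norm_mul, norm_mul, norm_expo, mul_one, es]
    have h2 : ‖s θ n‖ ≤ |C| * (1 + |(n : ℝ)|) ^ α := (hC θ n).trans
      (mul_le_mul_of_nonneg_right (le_abs_self C) (Real.rpow_nonneg (one_add_abs_pos _).le _))
    have h3 : (1 + |(n : ℝ)|) ^ (-2 : ℝ) =
        (1 + |(n : ℝ)|) ^ α * (1 + |(n : ℝ)|) ^ (-(α + 2)) := by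
      rw [← Real.rpow_add (one_add_abs_pos _)]
      congr 1
      ring
    calc _ ≤ _ := mul_le_mul h2 (hD n) (norm_nonneg _) ((norm_nonneg _).trans h2)
      _ = _ := by rw [h3]; ring

end

/-! ### Smooth even periodic functions as functions of `cos θ` -/

/-- Differentiating in `θ` under the integral brings out one factor `t`, so the induction must allow
every power `t ^ p`. -/
lemma contDiff_integral_pow_mul (n p : ℕ) {k : ℝ → ℂ} (hk : ContDiff ℝ ∞ k) :
    ContDiff ℝ n (fun θ : ℝ => ∫ t in (0 : ℝ)..1, ((t ^ p : ℝ) : ℂ) * k (t * θ)) := by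
  have hder : ∀ (p : ℕ) {k : ℝ → ℂ}, ContDiff ℝ ∞ k → ∀ θ : ℝ,
      HasDerivAt (fun θ : ℝ => ∫ t in (0 : ℝ)..1, ((t ^ p : ℝ) : ℂ) * k (t * θ))
        (∫ t in (0 : ℝ)..1, ((t ^ (p + 1) : ℝ) : ℂ) * deriv k (t * θ)) θ := by
    intro p k hk θ
    have hkc : Continuous k := hk.continuous
    have hdc : Continuous (deriv k) := hk.continuous_deriv (by simp)
    obtain ⟨B, hB⟩ := (isCompact_Icc (a := -(|θ| + 1)) (b := |θ| + 1)).exists_bound_of_continuousOn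
      hdc.continuousOn
    refine (intervalIntegral.hasDerivAt_integral_of_dominated_loc_of_deriv_le
      (μ := MeasureTheory.volume) (a := 0) (b := 1)
      (F := fun θ t => ((t ^ p : ℝ) : ℂ) * k (t * θ))
      (F' := fun θ t => ((t ^ (p + 1) : ℝ) : ℂ) * deriv k (t * θ))
      (s := Metric.ball θ 1) (bound := fun _ => B)
      (Metric.ball_mem_nhds θ one_pos) (Filter.Eventually.of_forall fun x => ?_) ?_ ?_
      (Filter.Eventually.of_forall fun t ht x hx => ?_)
      (continuous_const.intervalIntegrable _ _)
      (Filter.Eventually.of_forall fun t ht x hx => ?_)).2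
    · exact Continuous.aestronglyMeasurable (by fun_prop)
    · exact Continuous.intervalIntegrable (by fun_prop) _ _
    · exact Continuous.aestronglyMeasurable (by fun_prop)
    · rw [Set.uIoc_of_le zero_le_one] at ht
      rw [Metric.mem_ball, Real.dist_eq] at hx
      have hx' : |x| ≤ |θ| + 1 := by
        have := abs_sub_abs_le_abs_sub x θ
        linarith
      have h1 : |t * x| ≤ |θ| + 1 := by
        rw [abs_mul, abs_of_pos ht.1]
        exact (mul_le_of_le_one_left (abs_nonneg x) ht.2).trans hx'
      have h2 : ‖((t ^ (p + 1) : ℝ) : ℂ)‖ ≤ 1 := by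
        rw [Complex.norm_real, Real.norm_eq_abs, abs_of_nonneg (pow_nonneg ht.1.le _)]
        exact pow_le_one₀ ht.1.le ht.2
      rw [norm_mul]
      calc _ ≤ 1 * B := mul_le_mul h2 (hB _ (abs_le.1 h1)) (norm_nonneg _) zero_le_one
        _ = B := one_mul B
    · have h1 : HasDerivAt k (deriv k (t * x)) (t * x) :=
        (hk.differentiable (by simp) _).hasDerivAt
      have h2 := h1.scomp x ((hasDerivAt_id x).const_mul t)
      have h3 := h2.const_mul ((t ^ p : ℝ) : ℂ)
      refine h3.congr_deriv ?_
      simp only [mul_one, Complex.real_smul]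
      push_cast
      ring
  induction n generalizing p k with
  | zero =>
    refine contDiff_zero.2 (continuous_iff_continuousAt.2 fun θ => (hder p hk θ).continuousAt)
  | succ n ih =>
    rw [show ((n + 1 : ℕ) : WithTop ℕ∞) = (n : WithTop ℕ∞) + 1 by push_cast; rfl,
      contDiff_succ_iff_deriv]
    refine ⟨fun θ => (hder p hk θ).differentiableAt, by simp, ?_⟩
    rw [show deriv (fun θ : ℝ => ∫ t in (0 : ℝ)..1, ((t ^ p : ℝ) : ℂ) * k (t * θ)) = _ from
      funext fun θ => (hder p hk θ).deriv]
    exact ih (p + 1) (contDiff_infty_iff_deriv.1 hk).2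

/-- Hadamard's lemma in one variable. -/
lemma exists_contDiff_eq_sub_mul {f : ℝ → ℂ} (hf : ContDiff ℝ ∞ f) (a : ℝ) (ha : f a = 0) :
    ∃ g : ℝ → ℂ, ContDiff ℝ ∞ g ∧ ∀ θ, f θ = ((θ - a : ℝ) : ℂ) * g θ := by
  set k : ℝ → ℂ := fun x => deriv f (x + a) with hk
  have hkc : ContDiff ℝ ∞ k :=
    (contDiff_infty_iff_deriv.1 hf).2.comp (contDiff_id.add contDiff_const)
  refine ⟨fun θ => ∫ t in (0 : ℝ)..1, ((t ^ 0 : ℝ) : ℂ) * k (t * (θ - a)), ?_, fun θ => ?_⟩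
  · rw [contDiff_infty]
    intro n
    exact (contDiff_integral_pow_mul n 0 hkc).comp (contDiff_id.sub contDiff_const)
  · have h1 : ∀ t : ℝ, HasDerivAt (fun t : ℝ => f (t * (θ - a) + a))
        (((θ - a : ℝ) : ℂ) * k (t * (θ - a))) t := by
      intro t
      have h2 : HasDerivAt f (deriv f (t * (θ - a) + a)) (t * (θ - a) + a) :=
        (hf.differentiable (by simp) _).hasDerivAt
      have h3 := h2.scomp t (((hasDerivAt_id t).mul_const (θ - a)).add_const a)
      refine h3.congr_deriv ?_
      simp [hk]
    have h2 := intervalIntegral.integral_eq_sub_of_hasDerivAt (a := 0) (b := 1)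
      (fun t _ => h1 t) (Continuous.intervalIntegrable
        (by have := hkc.continuous; fun_prop) _ _)
    simp only [zero_mul, zero_add, one_mul, sub_add_cancel, ha, sub_zero] at h2
    simp only [pow_zero, Complex.ofReal_one, one_mul]
    rw [← h2, intervalIntegral.integral_const_mul]

/-- A smooth function vanishing on `πℤ` is a smooth multiple of `sin`. -/
lemma exists_contDiff_eq_sin_mul {h : ℝ → ℂ} (hh : ContDiff ℝ ∞ h)
    (hz : ∀ θ, Real.sin θ = 0 → h θ = 0) :
    ∃ g : ℝ → ℂ, ContDiff ℝ ∞ g ∧ ∀ θ, h θ = (Real.sin θ : ℂ) * g θ := by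
  -- At the zeros of `sin`, the value of the quotient is the one given by l'Hôpital's rule.
  set g : ℝ → ℂ := fun θ => if Real.sin θ = 0 then deriv h θ / (Real.cos θ : ℂ)
    else h θ / (Real.sin θ : ℂ) with hg
  have hsin : ContDiff ℝ ∞ (fun θ : ℝ => (Real.sin θ : ℂ)) :=
    Complex.ofRealCLM.contDiff.comp Real.contDiff_sin
  refine ⟨g, contDiff_iff_contDiffAt.2 fun a => ?_, fun θ => ?_⟩
  · by_cases ha : Real.sin a = 0
    · obtain ⟨H, hH, eH⟩ := exists_contDiff_eq_sub_mul hh a (hz a ha)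
      obtain ⟨S, hS, eS⟩ := exists_contDiff_eq_sub_mul hsin a (by exact_mod_cast ha)
      have der : ∀ {f G : ℝ → ℂ}, ContDiff ℝ ∞ G → (∀ θ, f θ = ((θ - a : ℝ) : ℂ) * G θ) →
          deriv f a = G a := by
        intro f G hG e
        have h1 : HasDerivAt (fun θ : ℝ => ((θ - a : ℝ) : ℂ)) 1 a :=
          ((hasDerivAt_id a).sub_const a).ofReal_comp
        have h2 := h1.mul ((hG.differentiable (by simp) a).hasDerivAt)
        rw [funext e]
        simpa using! h2.deriv
      have hcos : (Real.cos a : ℂ) = S a := by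
        rw [← der hS eS]
        exact ((Real.hasDerivAt_sin a).ofReal_comp).deriv.symm
      have hcos0 : Real.cos a ≠ 0 := by
        intro h0
        have := Real.sin_sq_add_cos_sq a
        rw [ha, h0] at this
        norm_num at this
      have hS0 : S a ≠ 0 := by rw [← hcos]; exact_mod_cast hcos0
      -- Dividing `h` and `sin` by `θ - a` leaves two smooth functions, and the denominator does not
      -- vanish at `a` since `sin` has a simple zero there.
      have hev : g =ᶠ[nhds a] fun θ => H θ / S θ := by
        filter_upwards [hS.continuous.continuousAt.eventually_ne hS0] with θ hθ
        by_cases hθa : θ = a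
        · subst hθa
          simp only [hg, ha, if_true, hcos, der hH eH]
        · have h1 : ((θ - a : ℝ) : ℂ) ≠ 0 := by exact_mod_cast sub_ne_zero.2 hθa
          have h2 : Real.sin θ ≠ 0 := by
            have : (Real.sin θ : ℂ) ≠ 0 := by rw [eS]; exact mul_ne_zero h1 hθ
            exact_mod_cast this
          simp only [hg, h2, if_false]
          rw [eS, eH, mul_div_mul_left _ _ h1]
      simp only [div_eq_mul_inv] at hev
      exact (hH.contDiffAt.mul (hS.contDiffAt.inv hS0)).congr_of_eventuallyEq hev
    · have hev : g =ᶠ[nhds a] fun θ => h θ / (Real.sin θ : ℂ) := by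
        filter_upwards [Real.continuous_sin.continuousAt.eventually_ne ha] with θ hθ
        simp only [hg, hθ, if_false]
      simp only [div_eq_mul_inv] at hev
      exact (hh.contDiffAt.mul (hsin.contDiffAt.inv (by exact_mod_cast ha))).congr_of_eventuallyEq hev
  · by_cases hθ : Real.sin θ = 0
    · rw [hz θ hθ, hθ]; simp
    · have : (Real.sin θ : ℂ) ≠ 0 := by exact_mod_cast hθ
      simp only [hg, hθ, if_false]
      field_simp

/-- Smooth, even and `2π`-periodic functions. -/
structure IsEvenPeriodic (f : ℝ → ℂ) : Prop where
  contDiff : ContDiff ℝ ∞ f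
  periodic : ∀ θ, f (θ + 2 * Real.pi) = f θ
  even : ∀ θ, f (-θ) = f θ

/-- Folding an angle into `[0, π]` only changes it by a sign and a multiple of `2π`. -/
lemma IsEvenPeriodic.arccos_cos {f : ℝ → ℂ} (hf : IsEvenPeriodic f) (θ : ℝ) :
    f (Real.arccos (Real.cos θ)) = f θ := by
  have hp : Function.Periodic f (2 * Real.pi) := hf.periodic
  have h1 : Real.cos (Real.arccos (Real.cos θ)) = Real.cos θ :=
    Real.cos_arccos (Real.neg_one_le_cos θ) (Real.cos_le_one θ)
  generalize Real.arccos (Real.cos θ) = φ at h1 ⊢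
  obtain ⟨k, hk | hk⟩ := Real.cos_eq_cos_iff.1 h1
  · rw [hk, show 2 * k * Real.pi + φ = φ + k * (2 * Real.pi) by ring]
    exact (hp.int_mul k φ).symm
  · rw [hk, show 2 * k * Real.pi - φ = -φ + k * (2 * Real.pi) by ring, ← hf.even φ]
    exact (hp.int_mul k (-φ)).symm

/-- Odd smooth `2π`-periodic functions are of the form `sin θ g(θ)`, with `g` even. -/
lemma exists_isEvenPeriodic_of_odd {h : ℝ → ℂ} (hh : ContDiff ℝ ∞ h)
    (hper : ∀ θ, h (θ + 2 * Real.pi) = h θ) (hodd : ∀ θ, h (-θ) = -h θ) :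
    ∃ g : ℝ → ℂ, IsEvenPeriodic g ∧ ∀ θ, h θ = (Real.sin θ : ℂ) * g θ := by
  have hz : ∀ θ, Real.sin θ = 0 → h θ = 0 := by
    intro θ hθ
    obtain ⟨n, rfl⟩ := Real.sin_eq_zero_iff.1 hθ
    have hp : Function.Periodic h (2 * Real.pi) := hper
    have h1 := hp.int_mul n (-(n * Real.pi))
    rw [show -(n * Real.pi) + n * (2 * Real.pi) = n * Real.pi by ring, hodd] at h1
    exact self_eq_neg.1 h1
  obtain ⟨g, hg, e⟩ := exists_contDiff_eq_sin_mul hh hz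
  -- Cancelling `sin θ` gives the parity and periodicity of `g` only off the zeros of `sin`; density
  -- and continuity give the rest.
  have hdense : Dense {θ : ℝ | Real.sin θ ≠ 0} := by
    have h1 : {θ : ℝ | Real.sin θ ≠ 0} = (Set.range fun n : ℤ => (n : ℝ) * Real.pi)ᶜ := by
      ext θ
      simp [Real.sin_eq_zero_iff]
    rw [h1]
    exact (Set.countable_range _).dense_compl ℝ
  refine ⟨g, ⟨hg, fun θ => ?_, fun θ => ?_⟩, e⟩
  · refine congrFun (Continuous.ext_on hdense
      (f := fun θ => g (θ + 2 * Real.pi)) (g := g) ?_ hg.continuous ?_) θ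
    · have := hg.continuous; fun_prop
    · intro θ hθ
      have hs : (Real.sin θ : ℂ) ≠ 0 := by exact_mod_cast hθ
      have h1 := hper θ
      rw [e, e, Real.sin_add_two_pi] at h1
      exact mul_left_cancel₀ hs h1
  · refine congrFun (Continuous.ext_on hdense
      (f := fun θ => g (-θ)) (g := g) ?_ hg.continuous ?_) θ
    · have := hg.continuous; fun_prop
    · intro θ hθ
      have hs : (Real.sin θ : ℂ) ≠ 0 := by exact_mod_cast hθ
      have h1 := hodd θ
      rw [e, e, Real.sin_neg] at h1
      rw [Complex.ofReal_neg, neg_mul, neg_inj] at h1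
      exact mul_left_cancel₀ hs h1

/-- The derivative of an even function is odd, hence divisible by `sin`. This factor will cancel the
singular `-1 / sin` coming from the derivative of `arccos`. -/
lemma IsEvenPeriodic.exists_deriv {f : ℝ → ℂ} (hf : IsEvenPeriodic f) :
    ∃ g : ℝ → ℂ, IsEvenPeriodic g ∧ ∀ θ, HasDerivAt f ((Real.sin θ : ℂ) * g θ) θ := by
  have hd : ∀ θ, HasDerivAt f (deriv f θ) θ := fun θ =>
    (hf.contDiff.differentiable (by simp) θ).hasDerivAt
  have hper : ∀ θ, deriv f (θ + 2 * Real.pi) = deriv f θ := by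
    intro θ
    have h1 := (hd (θ + 2 * Real.pi)).comp_add_const θ (2 * Real.pi)
    simp only [hf.periodic] at h1
    exact h1.unique (hd θ)
  have hodd : ∀ θ, deriv f (-θ) = -deriv f θ := by
    intro θ
    have h1 := HasDerivAt.scomp θ (hd (-θ)) (hasDerivAt_neg θ)
    rw [show (f ∘ fun x => -x) = f from funext hf.even] at h1
    rw [← h1.unique (hd θ)]
    simp
  obtain ⟨g, hg, e⟩ := exists_isEvenPeriodic_of_odd (contDiff_infty_iff_deriv.1 hf.contDiff).2
    hper hodd
  exact ⟨g, hg, fun θ => by rw [← e]; exact hd θ⟩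

/-- Chain rule in the interior. At `±1`, where `arccos` is not differentiable, the derivative is
recovered as the limit of the interior derivatives. -/
lemma IsEvenPeriodic.hasDerivWithinAt_arccos {f g : ℝ → ℂ} (hf : IsEvenPeriodic f)
    (hg : IsEvenPeriodic g) (e : ∀ θ, HasDerivAt f ((Real.sin θ : ℂ) * g θ) θ)
    {x : ℝ} (hx : x ∈ Set.Icc (-1 : ℝ) 1) :
    HasDerivWithinAt (fun x => f (Real.arccos x)) (-g (Real.arccos x)) (Set.Icc (-1) 1) x := by
  have hcf : Continuous (fun x => f (Real.arccos x)) :=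
    hf.contDiff.continuous.comp Real.continuous_arccos
  have hcg : Continuous (fun x => -g (Real.arccos x)) :=
    (hg.contDiff.continuous.comp Real.continuous_arccos).neg
  have hin : ∀ y ∈ Set.Ioo (-1 : ℝ) 1,
      HasDerivAt (fun x => f (Real.arccos x)) (-g (Real.arccos y)) y := by
    intro y hy
    have h1 := HasDerivAt.scomp y (e (Real.arccos y)) (Real.hasDerivAt_arccos hy.1.ne' hy.2.ne)
    refine h1.congr_deriv ?_
    have h2 : (0 : ℝ) < 1 - y ^ 2 := by nlinarith [hy.1, hy.2]
    have h3 : ((√(1 - y ^ 2) : ℝ) : ℂ) ≠ 0 := by exact_mod_cast (Real.sqrt_pos.2 h2).ne'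
    rw [Real.sin_arccos, Complex.real_smul]
    push_cast
    field_simp
  have hdiff : DifferentiableOn ℝ (fun x => f (Real.arccos x)) (Set.Ioo (-1) 1) :=
    fun y hy => (hin y hy).differentiableAt.differentiableWithinAt
  rcases eq_or_lt_of_le hx.1 with h1 | h1
  · subst h1
    refine (hasDerivWithinAt_Ici_of_tendsto_deriv hdiff hcf.continuousWithinAt
      (Ioo_mem_nhdsGT (by norm_num)) ?_).mono Set.Icc_subset_Ici_self
    refine (hcg.tendsto (-1)).mono_left nhdsWithin_le_nhds |>.congr' ?_
    filter_upwards [Ioo_mem_nhdsGT (by norm_num : (-1 : ℝ) < 1)] with y hy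
    exact (hin y hy).deriv.symm
  rcases eq_or_lt_of_le hx.2 with h2 | h2
  · subst h2
    refine (hasDerivWithinAt_Iic_of_tendsto_deriv hdiff hcf.continuousWithinAt
      (Ioo_mem_nhdsLT (by norm_num)) ?_).mono Set.Icc_subset_Iic_self
    refine (hcg.tendsto 1).mono_left nhdsWithin_le_nhds |>.congr' ?_
    filter_upwards [Ioo_mem_nhdsLT (by norm_num : (-1 : ℝ) < 1)] with y hy
    exact (hin y hy).deriv.symm
  · exact (hin x ⟨h1, h2⟩).hasDerivWithinAt

/-- Smooth even periodic functions are smooth functions of `cos θ ∈ [-1, 1]`. -/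
lemma IsEvenPeriodic.contDiffOn_arccos {f : ℝ → ℂ} (hf : IsEvenPeriodic f) :
    ContDiffOn ℝ ∞ (fun x => f (Real.arccos x)) (Set.Icc (-1) 1) := by
  rw [contDiffOn_infty]
  intro n
  have hu : UniqueDiffOn ℝ (Set.Icc (-1 : ℝ) 1) := uniqueDiffOn_Icc (by norm_num)
  induction n generalizing f with
  | zero =>
    exact contDiffOn_zero.2 (hf.contDiff.continuous.comp Real.continuous_arccos).continuousOn
  | succ n ih =>
    -- The derivative is `-g(arccos x)` with `g` again smooth, even and periodic, so the induction
    -- closes.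
    obtain ⟨g, hg, e⟩ := hf.exists_deriv
    rw [show ((n + 1 : ℕ) : WithTop ℕ∞) = (n : WithTop ℕ∞) + 1 by push_cast; rfl,
      contDiffOn_succ_iff_derivWithin hu]
    refine ⟨fun x hx => (hf.hasDerivWithinAt_arccos hg e hx).differentiableWithinAt, by simp, ?_⟩
    exact (ih hg).neg.congr fun x hx =>
      (hf.hasDerivWithinAt_arccos hg e hx).derivWithin (hu x hx)

/-! ### Reconstruction of a symmetric symbol from its pair -/

section

variable {α : ℝ} {σ : ℝ → ℤ → ℂ}

lemma contDiff_of_mem_symbolClass (hσ : σ ∈ symbolClass α) (n : ℤ) :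
    ContDiff ℝ ∞ (fun θ => σ θ n) := by
  obtain ⟨τ, hτ, e⟩ := hσ
  simp only [e]
  exact hτ.1.comp (contDiff_id.prodMk contDiff_const)

lemma periodic_of_mem_symbolClass (hσ : σ ∈ symbolClass α) (θ : ℝ) (n : ℤ) :
    σ (θ + 2 * Real.pi) n = σ θ n := by
  obtain ⟨τ, hτ, e⟩ := hσ
  simp only [e, hτ.2.1]

lemma exists_firstSymbol (hσ : σ ∈ symbolClass α) (hs : IsSymmetricSymbol σ) (n : ℕ) :
    IsEvenPeriodic (fun θ => (σ θ n + σ θ (-n)) / 2) ∧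
      (fun x => firstSymbol σ x n) = fun x => (fun θ => (σ θ n + σ θ (-n)) / 2) (Real.arccos x) := by
  refine ⟨⟨?_, fun θ => ?_, fun θ => ?_⟩, ?_⟩
  · exact ((contDiff_of_mem_symbolClass hσ n).add (contDiff_of_mem_symbolClass hσ (-n))).div_const 2
  · simp only [periodic_of_mem_symbolClass hσ]
  · have h1 := hs θ n
    have h2 := hs θ (-n)
    rw [neg_neg] at h2
    simp only [h1, h2, add_comm]
  · simp only [firstSymbol, symmetrize_eq hs]

/-- Symmetry of `σ` makes the difference `σ(θ, n) - σ(θ, -n)` odd in `θ`, hence divisible by `sin θ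
= √(1 - x²)`. The continuous quotient then gives the value of `extendFrom` at the endpoints. -/
lemma exists_secondSymbol (hσ : σ ∈ symbolClass α) (hs : IsSymmetricSymbol σ) (n : ℕ) :
    ∃ g : ℝ → ℂ, IsEvenPeriodic g ∧
      (∀ θ, (σ θ n - σ θ (-n)) / (2 * Complex.I) = (Real.sin θ : ℂ) * g θ) ∧
      ∀ x ∈ Set.Icc (-1 : ℝ) 1, secondSymbol σ x n = g (Real.arccos x) := by
  obtain ⟨g, hg, e⟩ := exists_isEvenPeriodic_of_odd
    (h := fun θ => (σ θ n - σ θ (-n)) / (2 * Complex.I))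
    (((contDiff_of_mem_symbolClass hσ n).sub (contDiff_of_mem_symbolClass hσ (-n))).div_const _)
    (fun θ => by simp only [periodic_of_mem_symbolClass hσ])
    (fun θ => by
      have h1 := hs θ n
      have h2 := hs θ (-n)
      rw [neg_neg] at h2
      simp only [h1, h2]
      ring)
  refine ⟨g, hg, e, fun x hx => ?_⟩
  simp only [secondSymbol, symmetrize_eq hs]
  have hcl : x ∈ closure (Set.Ioo (-1 : ℝ) 1) := by
    rwa [closure_Ioo (by norm_num)]
  refine extendFrom_eq hcl ?_
  have hc : Continuous (fun x => g (Real.arccos x)) :=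
    hg.contDiff.continuous.comp Real.continuous_arccos
  refine ((hc.tendsto x).mono_left nhdsWithin_le_nhds).congr' ?_
  filter_upwards [self_mem_nhdsWithin] with y hy
  have h2 : (0 : ℝ) < 1 - y ^ 2 := by nlinarith [hy.1, hy.2]
  have h3 : ((√(1 - y ^ 2) : ℝ) : ℂ) ≠ 0 := by exact_mod_cast (Real.sqrt_pos.2 h2).ne'
  have h4 := e (Real.arccos y)
  rw [Real.sin_arccos] at h4
  rw [← div_div, h4, mul_div_cancel_left₀ _ h3]

lemma contDiffOn_firstSymbol (hσ : σ ∈ symbolClass α) (hs : IsSymmetricSymbol σ) (n : ℕ) :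
    ContDiffOn ℝ ∞ (fun x => firstSymbol σ x n) (Set.Icc (-1) 1) := by
  obtain ⟨h1, h2⟩ := exists_firstSymbol hσ hs n
  rw [h2]
  exact h1.contDiffOn_arccos

lemma contDiffOn_secondSymbol (hσ : σ ∈ symbolClass α) (hs : IsSymmetricSymbol σ) (n : ℕ) :
    ContDiffOn ℝ ∞ (fun x => secondSymbol σ x n) (Set.Icc (-1) 1) := by
  obtain ⟨g, hg, -, h⟩ := exists_secondSymbol hσ hs n
  exact hg.contDiffOn_arccos.congr h

/-- The two entries encode the parts of `σ` that are even and odd in `n`. At `n = 0` the odd part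
vanishes, in agreement with `sign 0 = 0`. -/
lemma tildeSymbol_firstSymbol_secondSymbol (hσ : σ ∈ symbolClass α) (hs : IsSymmetricSymbol σ) :
    tildeSymbol (firstSymbol σ) (secondSymbol σ) = σ := by
  funext θ n
  obtain ⟨h1, h2⟩ := exists_firstSymbol hσ hs n.natAbs
  obtain ⟨g, hg, e, h3⟩ := exists_secondSymbol hσ hs n.natAbs
  have h4 : firstSymbol σ (Real.cos θ) n.natAbs = (σ θ n.natAbs + σ θ (-n.natAbs)) / 2 :=
    (congrFun h2 (Real.cos θ)).trans (h1.arccos_cos θ)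
  have h5 : secondSymbol σ (Real.cos θ) n.natAbs = g θ :=
    (h3 _ ⟨Real.neg_one_le_cos θ, Real.cos_le_one θ⟩).trans (hg.arccos_cos θ)
  have h6 : Complex.I * ((Real.sin θ : ℂ) * g θ) = (σ θ n.natAbs - σ θ (-n.natAbs)) / 2 := by
    rw [← e]
    field_simp
  have h7 : Complex.I * (Real.sin θ : ℂ) * (n.sign : ℂ) * g θ =
      n.sign * ((σ θ n.natAbs - σ θ (-n.natAbs)) / 2) := by
    rw [← h6]; ring
  rw [tildeSymbol, h4, h5, h7]
  rcases lt_trichotomy n 0 with h | h | h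
  · rw [Int.sign_eq_neg_one_of_neg h, show ((n.natAbs : ℕ) : ℤ) = -n by omega, neg_neg]
    push_cast
    ring
  · subst h
    simp
  · rw [Int.sign_eq_one_of_pos h, show ((n.natAbs : ℕ) : ℤ) = n by omega]
    push_cast
    ring

end

/-! ### Formal series as weak-* sums, and matrices of continuous operators. -/

namespace FormalSeries

variable {X Y : Type} {e : ℕ → X → ℂ} {f : ℕ → Y → ℂ}

@[simp] lemma coeff_sub (u v : FormalSeries e) : (u - v).coeff = u.coeff - v.coeff := rfl

lemma basis_coeff (n : ℕ) : (basis e n).coeff = Pi.single n 1 := rfl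

lemma hasSum_pairing (u : FormalSeries e) (φ : coeffInf) :
    HasSum (fun n : ℕ => (if n = 0 then 1 else 1 / 2) * (u.coeff n * φ.1 n)) (pairing u φ) := by
  have h1 := (summable_pairing u φ).hasSum.mul_left (1 / 2 : ℂ)
  have h2 := (hasSum_nat_add_iff (f := fun n : ℕ => (if n = 0 then (1 : ℂ) else 1 / 2) *
    (u.coeff n * φ.1 n)) 1 (g := (1 / 2 : ℂ) * ∑' n : ℕ, u.coeff (n + 1) * φ.1 (n + 1))).1
    (by simpa using h1)
  simpa [pairing, add_comm] using h2

lemma pairing_smul_basis (c : ℂ) (n : ℕ) (φ : coeffInf) :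
    pairing (c • basis e n) φ = (if n = 0 then 1 else 1 / 2) * (c * φ.1 n) := by
  refine (hasSum_pairing _ φ).unique ?_
  have h := hasSum_ite_eq n ((if n = 0 then (1 : ℂ) else 1 / 2) * (c * φ.1 n))
  convert h using 2 with m
  by_cases hm : m = n
  · subst hm; simp [basis_coeff]
  · simp [basis_coeff, hm]

/-- A formal series is the sum of its terms, in the weak-* topology. -/
lemma hasSum_basis (u : FormalSeries e) : HasSum (fun n => u.coeff n • basis e n) u := by
  have hind : Topology.IsInducing (pairingMap e) := ⟨rfl⟩
  rw [HasSum, hind.tendsto_nhds_iff, tendsto_pi_nhds]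
  intro φ
  have h1 := hasSum_pairing u φ
  simp only [← pairing_smul_basis (e := e)] at h1
  refine h1.congr fun s => ?_
  simp only [Function.comp_apply, map_sum, Finset.sum_apply]
  rfl

lemma single_mem_coeffInf (m : ℕ) : (Pi.single m 1 : ℕ → ℂ) ∈ coeffInf := by
  refine (Submodule.mem_iInf _).2 fun s => ?_
  refine summable_of_ne_finset_zero (s := {m}) fun n hn => ?_
  have : n ≠ m := by simpa using hn
  simp [this]

lemma basis_mem_TInf (n : ℕ) : basis e n ∈ TInf e :=
  fun s => (Submodule.mem_iInf _).1 (single_mem_coeffInf n) s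

/-- A coefficient is the pairing with `e_m`, up to the factor `2` that undoes the `1/2` of the
duality product for `m ≥ 1`. -/
lemma continuous_coeff (m : ℕ) : Continuous fun u : FormalSeries e => u.coeff m := by
  have h1 : Continuous fun u : FormalSeries e => pairing u ⟨_, single_mem_coeffInf m⟩ :=
    (continuous_apply (A := fun _ : coeffInf => ℂ) ⟨_, single_mem_coeffInf m⟩).comp
      (continuous_induced_dom (f := pairingMap e))
  have h2 : ∀ u : FormalSeries e, u.coeff m =
      (if m = 0 then 1 else 2) * pairing u ⟨_, single_mem_coeffInf m⟩ := by
    intro u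
    have h3 := (hasSum_pairing u ⟨_, single_mem_coeffInf m⟩).unique
      (hasSum_single m fun n hn => by simp [hn])
    rw [h3]
    split_ifs <;> simp
  simp only [h2]
  exact continuous_const.mul h1

/-- The coefficients of `A u` are given by the matrix of `A` in the basis `e_n`. -/
lemma hasSum_coeff_apply (A : FormalSeries e →L[ℂ] FormalSeries f) (u : FormalSeries e) (m : ℕ) :
    HasSum (fun n => u.coeff n * (A (basis e n)).coeff m) ((A u).coeff m) := by
  let L : FormalSeries f →L[ℂ] ℂ :=
    { toFun := fun u => u.coeff m, map_add' := fun _ _ => rfl, map_smul' := fun _ _ => rfl,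
      cont := continuous_coeff m }
  have h1 := (L.comp A).hasSum (hasSum_basis u)
  simpa only [ContinuousLinearMap.comp_apply, map_smul] using! h1

end FormalSeries

open FormalSeries

/-! ### The cosine transform -/

lemma chebT_cos (m : ℕ) (θ : ℝ) (h : Real.cos θ ∈ Set.Icc (-1 : ℝ) 1) :
    chebT m ⟨Real.cos θ, h⟩ = (expo m θ + expo (-m) θ) / 2 := by
  rw [chebT, show (m : ℤ) = ((m : ℕ) : ℤ) from rfl, Polynomial.Chebyshev.T_real_cos]
  push_cast
  rw [Complex.cos, expo, expo]
  push_cast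
  ring_nf

lemma cosTransform_natCast (u : TNegInf) (m : ℕ) :
    cosTransform u m = if m = 0 then u.coeff 0 else u.coeff m / 2 := by
  simp [cosTransform]

lemma cosTransform_neg (u : TNegInf) (k : ℤ) : cosTransform u (-k) = cosTransform u k := by
  simp [cosTransform]

lemma norm_cosTransform_le (u : TNegInf) (k : ℤ) : ‖cosTransform u k‖ ≤ ‖u.coeff k.natAbs‖ := by
  rw [cosTransform]
  split_ifs with h
  · simp [h]
  · rw [norm_div]
    have := norm_nonneg (u.coeff k.natAbs)
    norm_num

lemma norm_coeff_le_cosTransform (u : TNegInf) (m : ℕ) :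
    ‖u.coeff m‖ ≤ 2 * ‖cosTransform u m‖ := by
  rw [cosTransform_natCast]
  split_ifs with h
  · subst h; linarith [norm_nonneg (u.coeff 0)]
  · rw [norm_div, Complex.norm_ofNat, mul_div_cancel₀ _ two_ne_zero]

lemma cosTransform_sub (u v : TNegInf) (k : ℤ) :
    cosTransform (u - v) k = cosTransform u k - cosTransform v k := by
  simp only [cosTransform, coeff_sub, Pi.sub_apply]
  split_ifs <;> ring

lemma summable_cosTransform {u : TNegInf} (hu : Summable fun n => ‖u.coeff n‖) :
    Summable fun k => ‖cosTransform u k‖ := by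
  have h1 : Summable fun k : ℤ => ‖u.coeff k.natAbs‖ :=
    Summable.of_nat_of_neg (by simpa using hu) (by simpa using hu)
  exact Summable.of_nonneg_of_le (fun _ => norm_nonneg _) (norm_cosTransform_le u) h1

/-- Series on the two sides of the cosine transform. -/
lemma hasSum_of_hasSum_cosTransform {c : ℕ → ℂ} {d : ℤ → ℂ} (h0 : d 0 = c 0)
    (h1 : ∀ n : ℕ, n ≠ 0 → c n = d n + d (-n)) {a : ℂ} (hd : HasSum d a) : HasSum c a := by
  -- Folding `ℤ` onto `ℕ` counts the index `0` twice, so `d 0` is removed once.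
  have h2 := hd.nat_add_neg.sub (hasSum_ite_eq 0 (d 0))
  rw [add_sub_cancel_right] at h2
  refine h2.congr_fun fun n => ?_
  by_cases hn : n = 0
  · subst hn; simp [h0]
  · simp [hn, h1 n hn]

lemma hasSum_chebT_of_cosTransform {u : TNegInf} {θ : ℝ} {a : ℂ}
    (h : HasSum (fun k => cosTransform u k * expo k θ) a) (hθ : Real.cos θ ∈ Set.Icc (-1 : ℝ) 1) :
    HasSum (fun n => u.coeff n * chebT n ⟨Real.cos θ, hθ⟩) a := by
  refine hasSum_of_hasSum_cosTransform ?_ (fun n hn => ?_) h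
  · simp [cosTransform, chebT_cos, expo_zero]
  · rw [chebT_cos, cosTransform_neg, cosTransform_natCast, if_neg hn]
    ring

lemma fourierC_of_isFun {u : TNegInf} {g : Set.Icc (-1 : ℝ) 1 → ℂ} (h : u.IsFun g) :
    fourierC (fun θ => g ⟨Real.cos θ, Real.neg_one_le_cos θ, Real.cos_le_one θ⟩) =
      cosTransform u := by
  funext m
  have hs := summable_cosTransform h.1
  rw [← fourierC_tsum hs m]
  congr 1
  funext θ
  have h1 : Summable fun k => cosTransform u k * expo k θ :=
    Summable.of_norm (by simpa using hs)
  exact (h.2 _).unique (hasSum_chebT_of_cosTransform h1.hasSum _)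

/-! ### Operators with a symmetric symbol -/

/-- The image of `cos(n ·)` under `Op σ`. -/
def evenAct (σ : ℝ → ℤ → ℂ) (n : ℕ) (θ : ℝ) : ℂ :=
  (σ θ n * expo n θ + σ θ (-n) * expo (-n) θ) / 2

/-- `A` acts on the `T_n` as `Op σ` on the `cos(n ·)`. -/
def ActsBy (A : TNegInf →L[ℂ] TNegInf) (σ : ℝ → ℤ → ℂ) : Prop :=
  ∀ n : ℕ, cosTransform (A (basis chebT n)) = fourierC (evenAct σ n)

/-- Since `sin θ U_{n-1}(cos θ) = sin nθ`, the second term is `sin θ a₂ sin nθ`; writing sine and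
cosine with `e_{±n}` produces the `±i sin θ a₂` of the symbol. -/
lemma pair_apply_cos (a₁ a₂ : ℝ → ℕ → ℂ) (n : ℕ) (θ : ℝ)
    (h : Real.cos θ ∈ Set.Icc (-1 : ℝ) 1) :
    a₁ (Real.cos θ) n * chebT n ⟨Real.cos θ, h⟩ -
      (((1 - (Real.cos θ) ^ 2 : ℝ)) : ℂ) * a₂ (Real.cos θ) n *
        (((Polynomial.Chebyshev.U ℝ ((n : ℤ) - 1)).eval (Real.cos θ) : ℝ) : ℂ) =
      evenAct (tildeSymbol a₁ a₂) n θ := by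
  have h1 : ((1 - Real.cos θ ^ 2 : ℝ) : ℂ) = (Real.sin θ : ℂ) ^ 2 := by
    rw [← Real.sin_sq]; push_cast; rfl
  have h2 : (((Polynomial.Chebyshev.U ℝ ((n : ℤ) - 1)).eval (Real.cos θ) : ℝ) : ℂ) *
      (Real.sin θ : ℂ) = (expo (-n) θ - expo n θ) * Complex.I / 2 := by
    have h3 := Polynomial.Chebyshev.U_real_cos θ ((n : ℤ) - 1)
    rw [← Complex.ofReal_mul, h3]
    push_cast
    rw [Complex.sin, expo, expo]
    push_cast
    ring_nf
  rw [chebT_cos, evenAct, h1]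
  simp only [tildeSymbol, Int.natAbs_neg, Int.natAbs_natCast, Int.sign_neg]
  -- At `n = 0` the second term vanishes on both sides, through `U_{-1} = 0` and `sign 0 = 0`.
  rcases Nat.eq_zero_or_pos n with hn | hn
  · subst hn
    simp [expo_zero]
  · rw [Int.sign_eq_one_of_pos (by exact_mod_cast hn)]
    simp only [Int.cast_neg, Int.cast_one]
    linear_combination (-(Real.sin θ : ℂ) * a₂ (Real.cos θ) n) * h2

section

variable {α β : ℝ} {σ τ : ℝ → ℤ → ℂ}

lemma isPeriodicSym_mul_expo (hσ : σ ∈ symbolClass α) (n : ℤ) :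
    IsPeriodicSym 0 (fun θ _ => σ θ n * expo n θ) := by
  have h1 : IsRapid (fourierC (expo n)) := by
    intro L
    refine ⟨(1 + |(n : ℝ)|) ^ L, fun k => ?_⟩
    rw [fourierC_expo]
    split_ifs with h
    · rw [h, ← Real.rpow_add (one_add_abs_pos _)]
      simp
    · rw [norm_zero]
      exact mul_nonneg (Real.rpow_nonneg (one_add_abs_pos _).le _)
        (Real.rpow_nonneg (one_add_abs_pos _).le _)
  simpa only [Op_fourierC_expo] using isPeriodicSym_Op hσ h1

lemma isPeriodicSym_evenAct (hσ : σ ∈ symbolClass α) (n : ℕ) :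
    IsPeriodicSym 0 (fun θ _ => evenAct σ n θ) := by
  have h1 := ((isPeriodicSym_mul_expo hσ n).add (isPeriodicSym_mul_expo hσ (-n))).const_mul (1 / 2)
  convert h1 using 3
  rw [evenAct]
  ring

lemma fourierC_evenAct (hσ : σ ∈ symbolClass α) (n : ℕ) (m : ℤ) :
    fourierC (evenAct σ n) m =
      (fourierC (fun θ => σ θ n * expo n θ) m +
        fourierC (fun θ => σ θ (-n) * expo (-n) θ) m) / 2 := by
  rw [← fourierC_add ((isPeriodicSym_mul_expo hσ n).continuous_fst 0)
    ((isPeriodicSym_mul_expo hσ (-n)).continuous_fst 0), div_eq_inv_mul, ← fourierC_const_mul]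
  congr 1
  funext θ
  rw [evenAct, div_eq_inv_mul]

lemma IsSymbolPair.actsBy {A : TNegInf →L[ℂ] TNegInf} {a₁ a₂ : ℝ → ℕ → ℂ}
    (h : IsSymbolPair α A a₁ a₂) : ActsBy A (tildeSymbol a₁ a₂) := by
  intro n
  rw [← fourierC_of_isFun (h.apply_T n)]
  congr 1
  funext θ
  exact pair_apply_cos a₁ a₂ n θ _

/-- The image of `cos(n ·)` is smooth, so its Fourier series is absolutely summable and sums to it;
read through `x = cos θ`, this is the Chebyshev series of `A T_n`. -/
lemma ActsBy.isSymbolPair {A : TNegInf →L[ℂ] TNegInf} {a₁ a₂ : ℝ → ℕ → ℂ}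
    (h₁ : ∀ n, ContDiffOn ℝ ∞ (fun x => a₁ x n) (Set.Icc (-1) 1))
    (h₂ : ∀ n, ContDiffOn ℝ ∞ (fun x => a₂ x n) (Set.Icc (-1) 1))
    (hσ : tildeSymbol a₁ a₂ ∈ symbolClass α) (hA : ActsBy A (tildeSymbol a₁ a₂)) :
    IsSymbolPair α A a₁ a₂ := by
  refine ⟨h₁, h₂, fun n => ⟨?_, fun x => ?_⟩, hσ⟩
  · have h3 := (isPeriodicSym_evenAct hσ n).summable_fourierC 0
    rw [← hA n] at h3
    have h4 := h3.comp_injective Nat.cast_injective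
    exact Summable.of_nonneg_of_le (fun _ => norm_nonneg _)
      (fun m => norm_coeff_le_cosTransform _ m) (h4.mul_left 2)
  · obtain ⟨θ, hθ⟩ : ∃ θ : ℝ, Real.cos θ = x := ⟨Real.arccos x, Real.cos_arccos x.2.1 x.2.2⟩
    obtain ⟨x, hx⟩ := x
    simp only at hθ
    subst hθ
    beta_reduce
    rw [pair_apply_cos]
    have h3 := (isPeriodicSym_evenAct hσ n).hasSum_fourierC θ 0
    rw [← hA n] at h3
    exact hasSum_chebT_of_cosTransform h3 hx

/-- A symmetric symbol of an operator yields a pair of symbols. -/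
lemma ActsBy.isSymbolPair_of_symmetric {A : TNegInf →L[ℂ] TNegInf} (hσ : σ ∈ symbolClass α)
    (hs : IsSymmetricSymbol σ) (hA : ActsBy A σ) :
    IsSymbolPair α A (firstSymbol σ) (secondSymbol σ) := by
  have h := tildeSymbol_firstSymbol_secondSymbol hσ hs
  exact ActsBy.isSymbolPair (contDiffOn_firstSymbol hσ hs) (contDiffOn_secondSymbol hσ hs)
    (by rwa [h]) (by rwa [h])

/-- `𝒞 A u = Op(σ) 𝒞 u` for smooth `u`. -/
lemma ActsBy.cosTransform_apply {A : TNegInf →L[ℂ] TNegInf} (hσ : σ ∈ symbolClass α)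
    (hA : ActsBy A σ) {u : TNegInf} (hu : IsRapid (cosTransform u)) :
    cosTransform (A u) = fourierC (Op σ (cosTransform u)) := by
  funext m
  -- Weak-* continuity of `A` allows expanding `A u` coefficientwise over the `T_n`.
  have h1 : HasSum (fun n => u.coeff n * cosTransform (A (basis chebT n)) m)
      (cosTransform (A u) m) := by
    have h2 := hasSum_coeff_apply A u m.natAbs
    by_cases hm : m = 0
    · subst hm
      simpa [cosTransform] using h2
    · simp only [cosTransform, hm, if_false, ← mul_div_assoc]
      exact h2.div_const 2
  refine h1.unique ?_
  simp only [hA _, fourierC_evenAct hσ]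
  refine hasSum_of_hasSum_cosTransform ?_ (fun n hn => ?_) (hasSum_fourierC_Op hσ hu m)
  · simp [cosTransform]
  · rw [cosTransform_neg, cosTransform_natCast, if_neg hn]
    ring

/-- `B T_n` is smooth, so the action of `A` on it is known, beyond the basis. Its Fourier
coefficients are half the sum of those of `τ(·, ±n) e_{±n}`, and `Op σ` sends these two functions to
the composite symbol times `e_{±n}`. -/
lemma ActsBy.comp {A B : TNegInf →L[ℂ] TNegInf} (hσ : σ ∈ symbolClass α)
    (hτ : τ ∈ symbolClass β) (hA : ActsBy A σ) (hB : ActsBy B τ) :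
    ActsBy (A.comp B) (compSymbol σ τ) := by
  intro n
  have hr : ∀ k : ℤ, IsRapid (fourierC (fun θ => τ θ k * expo k θ)) := fun k =>
    isRapid_fourierC (isPeriodicSym_mul_expo hτ k)
  have hrapid : IsRapid (cosTransform (B (basis chebT n))) := by
    rw [hB n]
    exact isRapid_fourierC (isPeriodicSym_evenAct hτ n)
  have hcs : ∀ (k : ℤ) (θ : ℝ), compSymbol σ τ θ k * expo k θ =
      Op σ (fourierC (fun θ => τ θ k * expo k θ)) θ := by
    intro k θ
    have h1 : Op τ (fourierC (expo k)) = fun θ => τ θ k * expo k θ :=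
      funext (Op_fourierC_expo τ k)
    rw [compSymbol, h1, conj_expo]
    linear_combination (Op σ (fourierC (fun θ => τ θ k * expo k θ)) θ) * expo_neg_mul_self k θ
  have hsum : ∀ (k : ℤ) (θ : ℝ), Summable fun m =>
      σ θ m * fourierC (fun θ => τ θ k * expo k θ) m * expo m θ := by
    intro k θ
    obtain ⟨s, hs, es⟩ := mem_symbolClass_iff.1 hσ
    obtain ⟨C, hC⟩ := hs.exists_bound
    obtain ⟨D, hD⟩ := hr k (α + 2)
    refine Summable.of_norm_bounded
      (((summable_one_add_abs_rpow le_rfl).mul_left (|C| * D))) fun m => ?_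
    rw [norm_mul, norm_mul, norm_expo, mul_one, es]
    have h2 : ‖s θ m‖ ≤ |C| * (1 + |(m : ℝ)|) ^ α := (hC θ m).trans
      (mul_le_mul_of_nonneg_right (le_abs_self C) (Real.rpow_nonneg (one_add_abs_pos _).le _))
    have h3 : (1 + |(m : ℝ)|) ^ (-2 : ℝ) =
        (1 + |(m : ℝ)|) ^ α * (1 + |(m : ℝ)|) ^ (-(α + 2)) := by
      rw [← Real.rpow_add (one_add_abs_pos _)]
      congr 1
      ring
    calc _ ≤ _ := mul_le_mul h2 (hD m) (norm_nonneg _) ((norm_nonneg _).trans h2)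
      _ = _ := by rw [h3]; ring
  rw [ContinuousLinearMap.comp_apply, hA.cosTransform_apply hσ hrapid, hB n]
  congr 1
  funext θ
  rw [evenAct, hcs, hcs, Op, Op, Op, ← (hsum n θ).tsum_add (hsum (-n) θ), ← tsum_div_const]
  refine tsum_congr fun m => ?_
  rw [fourierC_evenAct hτ]
  ring

lemma ActsBy.sub {A B : TNegInf →L[ℂ] TNegInf} (hσ : σ ∈ symbolClass α)
    (hτ : τ ∈ symbolClass β) (hA : ActsBy A σ) (hB : ActsBy B τ) :
    ActsBy (A - B) (fun θ n => σ θ n - τ θ n) := by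
  intro n
  funext m
  rw [_root_.sub_apply, cosTransform_sub, hA n, hB n]
  have h1 := fourierC_add ((isPeriodicSym_evenAct hσ n).continuous_fst 0)
    (((isPeriodicSym_evenAct hτ n).const_mul (-1)).continuous_fst 0) m
  rw [fourierC_const_mul] at h1
  rw [show evenAct (fun θ n => σ θ n - τ θ n) n = fun θ => evenAct σ n θ + -1 * evenAct τ n θ from
    funext fun θ => by simp only [evenAct]; ring, h1]
  ring

end

/-! ### Continuity on the scale of spaces -/

/-- Schur's test, on finite sets. -/
lemma sum_sq_sum_le {K : ℕ → ℕ → ℝ} (hK : ∀ m n, 0 ≤ K m n) {κ : ℝ}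
    (h₁ : ∀ m (G : Finset ℕ), ∑ n ∈ G, K m n ≤ κ) (h₂ : ∀ n (F : Finset ℕ), ∑ m ∈ F, K m n ≤ κ)
    (a : ℕ → ℝ) (F G : Finset ℕ) :
    ∑ m ∈ F, (∑ n ∈ G, K m n * a n) ^ 2 ≤ κ ^ 2 * ∑ n ∈ G, a n ^ 2 := by
  have hκ : 0 ≤ κ := by simpa using h₁ 0 ∅
  have h3 : ∀ m, (∑ n ∈ G, K m n * a n) ^ 2 ≤ κ * ∑ n ∈ G, K m n * a n ^ 2 := by
    intro m
    -- Cauchy–Schwarz for the splitting `K a = √K · (√K a)`.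
    have h4 := Finset.sum_mul_sq_le_sq_mul_sq G (fun n => √(K m n)) (fun n => √(K m n) * a n)
    simp only [← mul_assoc, mul_pow, Real.mul_self_sqrt (hK _ _), Real.sq_sqrt (hK _ _)] at h4
    exact h4.trans (mul_le_mul_of_nonneg_right (h₁ m G)
      (Finset.sum_nonneg fun n _ => mul_nonneg (hK m n) (sq_nonneg _)))
  calc ∑ m ∈ F, (∑ n ∈ G, K m n * a n) ^ 2
      ≤ ∑ m ∈ F, κ * ∑ n ∈ G, K m n * a n ^ 2 := Finset.sum_le_sum fun m _ => h3 m
    _ = κ * ∑ n ∈ G, (∑ m ∈ F, K m n) * a n ^ 2 := by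
        rw [← Finset.mul_sum, Finset.sum_comm]
        simp only [Finset.sum_mul]
    _ ≤ κ * ∑ n ∈ G, κ * a n ^ 2 := by
        refine mul_le_mul_of_nonneg_left (Finset.sum_le_sum fun n _ => ?_) hκ
        exact mul_le_mul_of_nonneg_right (h₂ n F) (sq_nonneg _)
    _ = κ ^ 2 * ∑ n ∈ G, a n ^ 2 := by rw [← Finset.mul_sum]; ring

lemma norm_fourierC_mul_expo_le {α : ℝ} {σ : ℝ → ℤ → ℂ} (hσ : σ ∈ symbolClass α) (L : ℝ) :
    ∃ C : ℝ, 0 ≤ C ∧ ∀ n m : ℤ, ‖fourierC (fun θ => σ θ n * expo n θ) m‖ ≤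
      C * (1 + |((m - n : ℤ) : ℝ)|) ^ (-L) * (1 + |(n : ℝ)|) ^ α := by
  obtain ⟨s, hs, es⟩ := mem_symbolClass_iff.1 hσ
  obtain ⟨C, hC⟩ := hs.fourierC_symBound L
  refine ⟨|C|, abs_nonneg C, fun n m => ?_⟩
  simp only [es]
  rw [fourierC_mul_expo (fun θ => s θ n)]
  refine (hC (m - n) 0 n).trans ?_
  gcongr
  exact le_abs_self C

/-- Decay of the matrix of `A` away from the diagonal. -/
lemma ActsBy.norm_coeff_le {α : ℝ} {σ : ℝ → ℤ → ℂ} (hσ : σ ∈ symbolClass α)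
    {A : TNegInf →L[ℂ] TNegInf} (hA : ActsBy A σ) {L : ℝ} (hL : 0 ≤ L) :
    ∃ C : ℝ, 0 ≤ C ∧ ∀ n m : ℕ, ‖(A (basis chebT n)).coeff m‖ ≤
      C * (1 + |(m : ℝ) - n|) ^ (-L) * (1 + (n : ℝ)) ^ α := by
  obtain ⟨C, hC0, hC⟩ := norm_fourierC_mul_expo_le hσ L
  refine ⟨2 * C, by positivity, fun n m => (norm_coeff_le_cosTransform _ m).trans ?_⟩
  rw [hA n, fourierC_evenAct hσ, norm_div, Complex.norm_ofNat, mul_div_cancel₀ _ two_ne_zero]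
  have h1 := hC n m
  have h2 := hC (-n) m
  -- The contribution of `e_{-n}` is centred at `-n`, which is farther from `m ≥ 0` than `n` is.
  have h3 : (1 + |((m - -(n : ℤ) : ℤ) : ℝ)|) ^ (-L) ≤ (1 + |(m : ℝ) - n|) ^ (-L) := by
    refine Real.rpow_le_rpow_of_nonpos (one_add_abs_pos _) ?_ (by linarith)
    push_cast
    have hm : (0 : ℝ) ≤ m := m.cast_nonneg
    have hn : (0 : ℝ) ≤ n := n.cast_nonneg
    rw [sub_neg_eq_add, abs_of_nonneg (by positivity : (0 : ℝ) ≤ m + n)]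
    have := abs_sub (m : ℝ) n
    rw [abs_of_nonneg hm, abs_of_nonneg hn] at this
    linarith
  have h4 : C * (1 + |((m - -(n : ℤ) : ℤ) : ℝ)|) ^ (-L) * (1 + (n : ℝ)) ^ α ≤
      C * (1 + |(m : ℝ) - n|) ^ (-L) * (1 + (n : ℝ)) ^ α := by
    gcongr
  simp only [Int.cast_neg, Int.cast_natCast, abs_neg, Nat.abs_cast] at h1 h2
  push_cast at h1
  calc _ ≤ _ := norm_add_le _ _
    _ ≤ _ := add_le_add h1 (h2.trans h4)
    _ = _ := by ring

/-- The two weights are equivalent. -/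
lemma one_add_sq_rpow_le (s : ℝ) (n : ℕ) :
    (1 + (n : ℝ) ^ 2) ^ s ≤ 2 ^ |s| * ((1 + (n : ℝ)) ^ s) ^ 2 ∧
      ((1 + (n : ℝ)) ^ s) ^ 2 ≤ 2 ^ |s| * (1 + (n : ℝ) ^ 2) ^ s := by
  have hn : (0 : ℝ) ≤ n := n.cast_nonneg
  have h1 : ((1 + (n : ℝ)) ^ s) ^ 2 = ((1 + (n : ℝ)) ^ 2) ^ s := by
    rw [← Real.rpow_natCast, ← Real.rpow_natCast, ← Real.rpow_mul (by positivity),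
      ← Real.rpow_mul (by positivity), mul_comm]
  rw [h1]
  have hp : (0 : ℝ) < 1 + (n : ℝ) ^ 2 := by positivity
  have hq : (0 : ℝ) < (1 + (n : ℝ)) ^ 2 := by positivity
  have h2 : 1 + (n : ℝ) ^ 2 ≤ (1 + n) ^ 2 := by nlinarith
  have h3 : (1 + (n : ℝ)) ^ 2 ≤ 2 * (1 + (n : ℝ) ^ 2) := by nlinarith [sq_nonneg ((n : ℝ) - 1)]
  rcases le_total 0 s with hs | hs
  · rw [abs_of_nonneg hs]
    constructor
    · have h4 := Real.rpow_le_rpow hp.le h2 hs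
      have h5 : (1 : ℝ) ≤ 2 ^ s := Real.one_le_rpow one_le_two hs
      nlinarith [Real.rpow_nonneg hq.le s]
    · rw [← Real.mul_rpow two_pos.le hp.le]
      exact Real.rpow_le_rpow hq.le h3 hs
  · rw [abs_of_nonpos hs]
    constructor
    · have h4 := Real.rpow_le_rpow_of_nonpos hq h3 hs
      rw [Real.mul_rpow two_pos.le hp.le] at h4
      have h5 : (2 : ℝ) ^ (-s) * 2 ^ s = 1 := by
        rw [← Real.rpow_add two_pos]; simp
      calc (1 + (n : ℝ) ^ 2) ^ s = 2 ^ (-s) * (2 ^ s * (1 + (n : ℝ) ^ 2) ^ s) := by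
            rw [← mul_assoc, h5, one_mul]
        _ ≤ _ := mul_le_mul_of_nonneg_left h4 (by positivity)
    · have h4 := Real.rpow_le_rpow_of_nonpos hp h2 hs
      have h5 : (1 : ℝ) ≤ 2 ^ (-s) := Real.one_le_rpow one_le_two (by linarith)
      nlinarith [Real.rpow_nonneg hp.le s]

/-- Continuity of `A` for the squared norms with equal weights on all the coefficients. -/
lemma ActsBy.tsum_le {α : ℝ} {σ : ℝ → ℤ → ℂ} (hσ : σ ∈ symbolClass α)
    {A : TNegInf →L[ℂ] TNegInf} (hA : ActsBy A σ) (s : ℝ) :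
    ∃ D : ℝ, 0 ≤ D ∧ ∀ u : TNegInf, u.coeff ∈ coeffSpace s →
      (A u).coeff ∈ coeffSpace (s - α) ∧
      ∑' n : ℕ, (1 + (n : ℝ) ^ 2) ^ (s - α) * ‖(A u).coeff n‖ ^ 2 ≤
        D * ∑' n : ℕ, (1 + (n : ℝ) ^ 2) ^ s * ‖u.coeff n‖ ^ 2 := by
  -- Of this decay, `|s - α|` pays for moving the weight from `m` to `n` by Peetre's inequality, and
  -- `2` makes the kernel summable.
  obtain ⟨C, hC0, hC⟩ := hA.norm_coeff_le hσ (L := |s - α| + 2) (by positivity)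
  set κ : ℝ := C * ∑' k : ℤ, (1 + |(k : ℝ)|) ^ (-2 : ℝ) with hκ
  set K : ℕ → ℕ → ℝ := fun m n => C * (1 + |(m : ℝ) - n|) ^ (-2 : ℝ) with hKdef
  have hK : ∀ m n, 0 ≤ K m n := fun m n =>
    mul_nonneg hC0 (Real.rpow_nonneg (one_add_abs_pos _).le _)
  have hsum : ∀ (φ : ℕ → ℤ), Function.Injective φ → ∀ G : Finset ℕ,
      ∑ n ∈ G, C * (1 + |(φ n : ℝ)|) ^ (-2 : ℝ) ≤ κ := by
    intro φ hφ G
    rw [← Finset.mul_sum]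
    refine mul_le_mul_of_nonneg_left ?_ hC0
    have h1 := (summable_one_add_abs_rpow le_rfl).sum_le_tsum (G.map ⟨φ, hφ⟩)
      (fun k _ => Real.rpow_nonneg (one_add_abs_pos _).le _)
    simpa using h1
  have h₁ : ∀ m (G : Finset ℕ), ∑ n ∈ G, K m n ≤ κ := by
    intro m G
    simpa only [Int.cast_sub, Int.cast_natCast] using hsum (fun n => (m : ℤ) - n) (fun a b h => by simpa using h) G
  have h₂ : ∀ n (F : Finset ℕ), ∑ m ∈ F, K m n ≤ κ := by
    intro n F
    simpa only [Int.cast_sub, Int.cast_natCast] using hsum (fun m => (m : ℤ) - n) (fun a b h => by simpa using h) F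
  have hentry : ∀ m n : ℕ, (1 + (m : ℝ)) ^ (s - α) * ‖(A (basis chebT n)).coeff m‖ ≤
      K m n * (1 + (n : ℝ)) ^ s := by
    intro m n
    have hm : (0 : ℝ) ≤ m := m.cast_nonneg
    have hn : (0 : ℝ) ≤ n := n.cast_nonneg
    have h3 := peetre (s - α) n (m - n)
    rw [add_sub_cancel, abs_of_nonneg hm, abs_of_nonneg hn] at h3
    have h4 : (1 + |(m : ℝ) - n|) ^ |s - α| * (1 + |(m : ℝ) - n|) ^ (-(|s - α| + 2)) =
        (1 + |(m : ℝ) - n|) ^ (-2 : ℝ) := by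
      rw [← Real.rpow_add (one_add_abs_pos _)]
      congr 1
      ring
    have h5 : (1 + (n : ℝ)) ^ (s - α) * (1 + (n : ℝ)) ^ α = (1 + (n : ℝ)) ^ s := by
      rw [← Real.rpow_add (by positivity), sub_add_cancel]
    calc _ ≤ _ := mul_le_mul h3 (hC n m) (norm_nonneg _) (by positivity)
      _ = C * ((1 + |(m : ℝ) - n|) ^ |s - α| * (1 + |(m : ℝ) - n|) ^ (-(|s - α| + 2))) *
          ((1 + (n : ℝ)) ^ (s - α) * (1 + (n : ℝ)) ^ α) := by ring
      _ = _ := by rw [h4, h5]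
  -- Here `κ²` is Schur's constant; the powers of two convert between `(1 + n²)^s` and `(1 +
  -- n)^{2s}` in target and source.
  refine ⟨2 ^ |s - α| * (κ ^ 2 * 2 ^ |s|), by positivity, fun u hu => ?_⟩
  have hu' : Summable fun n : ℕ => (1 + (n : ℝ) ^ 2) ^ s * ‖u.coeff n‖ ^ 2 := hu
  set Q := ∑' n : ℕ, (1 + (n : ℝ) ^ 2) ^ s * ‖u.coeff n‖ ^ 2 with hQ
  have hfin : ∀ F : Finset ℕ,
      ∑ m ∈ F, ((1 + (m : ℝ)) ^ (s - α) * ‖(A u).coeff m‖) ^ 2 ≤ κ ^ 2 * (2 ^ |s| * Q) := by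
    intro F
    -- Coefficients of `A u` are limits of finite sums, so bounds uniform in the finite sets `F` and
    -- `G` suffice; they also prove that `A u` lies in the target space.
    have hlim : Filter.Tendsto (fun G : Finset ℕ => ∑ m ∈ F, ((1 + (m : ℝ)) ^ (s - α) *
        ‖∑ n ∈ G, u.coeff n * (A (basis chebT n)).coeff m‖) ^ 2) Filter.atTop
        (nhds (∑ m ∈ F, ((1 + (m : ℝ)) ^ (s - α) * ‖(A u).coeff m‖) ^ 2)) := by
      refine tendsto_finsetSum F fun m _ => ?_
      exact ((Filter.Tendsto.norm (hasSum_coeff_apply A u m)).const_mul _).pow 2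
    refine le_of_tendsto hlim (Filter.Eventually.of_forall fun G => ?_)
    have h6 : ∀ m : ℕ, (1 + (m : ℝ)) ^ (s - α) *
        ‖∑ n ∈ G, u.coeff n * (A (basis chebT n)).coeff m‖ ≤
        ∑ n ∈ G, K m n * ((1 + (n : ℝ)) ^ s * ‖u.coeff n‖) := by
      intro m
      calc _ ≤ (1 + (m : ℝ)) ^ (s - α) *
            ∑ n ∈ G, ‖u.coeff n * (A (basis chebT n)).coeff m‖ :=
          mul_le_mul_of_nonneg_left (norm_sum_le _ _) (by positivity)
        _ = ∑ n ∈ G, (1 + (m : ℝ)) ^ (s - α) * ‖(A (basis chebT n)).coeff m‖ * ‖u.coeff n‖ := by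
          rw [Finset.mul_sum]
          refine Finset.sum_congr rfl fun n _ => ?_
          rw [norm_mul]; ring
        _ ≤ ∑ n ∈ G, K m n * (1 + (n : ℝ)) ^ s * ‖u.coeff n‖ :=
          Finset.sum_le_sum fun n _ => mul_le_mul_of_nonneg_right (hentry m n) (norm_nonneg _)
        _ = _ := Finset.sum_congr rfl fun n _ => by ring
    calc _ ≤ ∑ m ∈ F, (∑ n ∈ G, K m n * ((1 + (n : ℝ)) ^ s * ‖u.coeff n‖)) ^ 2 :=
          Finset.sum_le_sum fun m _ => pow_le_pow_left₀ (by positivity) (h6 m) 2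
      _ ≤ κ ^ 2 * ∑ n ∈ G, ((1 + (n : ℝ)) ^ s * ‖u.coeff n‖) ^ 2 :=
          sum_sq_sum_le hK h₁ h₂ _ F G
      _ ≤ κ ^ 2 * ∑ n ∈ G, 2 ^ |s| * ((1 + (n : ℝ) ^ 2) ^ s * ‖u.coeff n‖ ^ 2) := by
          refine mul_le_mul_of_nonneg_left (Finset.sum_le_sum fun n _ => ?_) (sq_nonneg κ)
          rw [mul_pow, ← mul_assoc]
          exact mul_le_mul_of_nonneg_right (one_add_sq_rpow_le s n).2 (sq_nonneg _)
      _ ≤ κ ^ 2 * (2 ^ |s| * Q) := by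
          rw [← Finset.mul_sum]
          refine mul_le_mul_of_nonneg_left (mul_le_mul_of_nonneg_left ?_ (by positivity))
            (sq_nonneg κ)
          exact hu'.sum_le_tsum G fun n _ => by positivity
  have hfin' : ∀ F : Finset ℕ, ∑ m ∈ F, (1 + (m : ℝ) ^ 2) ^ (s - α) * ‖(A u).coeff m‖ ^ 2 ≤
      2 ^ |s - α| * (κ ^ 2 * 2 ^ |s|) * Q := by
    intro F
    calc _ ≤ ∑ m ∈ F, 2 ^ |s - α| * ((1 + (m : ℝ)) ^ (s - α) * ‖(A u).coeff m‖) ^ 2 := by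
          refine Finset.sum_le_sum fun m _ => ?_
          rw [mul_pow, ← mul_assoc]
          exact mul_le_mul_of_nonneg_right (one_add_sq_rpow_le (s - α) m).1 (sq_nonneg _)
      _ = 2 ^ |s - α| * ∑ m ∈ F, ((1 + (m : ℝ)) ^ (s - α) * ‖(A u).coeff m‖) ^ 2 := by
          rw [Finset.mul_sum]
      _ ≤ 2 ^ |s - α| * (κ ^ 2 * (2 ^ |s| * Q)) :=
          mul_le_mul_of_nonneg_left (hfin F) (by positivity)
      _ = _ := by ring
  have hsm : Summable fun m : ℕ => (1 + (m : ℝ) ^ 2) ^ (s - α) * ‖(A u).coeff m‖ ^ 2 :=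
    summable_of_sum_le (fun m => by positivity) hfin'
  exact ⟨hsm, hsm.tsum_le_of_sum_le hfin'⟩

lemma normT_sq {X : Type} {e : ℕ → X → ℂ} (s : ℝ) (u : FormalSeries e) :
    u.normT s ^ 2 = ‖u.coeff 0‖ ^ 2 +
      (1 / 2) * ∑' n : ℕ, (1 + ((n : ℝ) + 1) ^ 2) ^ s * ‖u.coeff (n + 1)‖ ^ 2 :=
  Real.sq_sqrt (add_nonneg (sq_nonneg _)
    (mul_nonneg (by norm_num) (tsum_nonneg fun n => by positivity)))

lemma normT_sq_le_tsum {X : Type} {e : ℕ → X → ℂ} {s : ℝ} {u : FormalSeries e}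
    (hu : u.coeff ∈ coeffSpace s) :
    u.normT s ^ 2 ≤ ∑' n : ℕ, (1 + (n : ℝ) ^ 2) ^ s * ‖u.coeff n‖ ^ 2 ∧
      ∑' n : ℕ, (1 + (n : ℝ) ^ 2) ^ s * ‖u.coeff n‖ ^ 2 ≤ 2 * u.normT s ^ 2 := by
  have hu' : Summable fun n : ℕ => (1 + (n : ℝ) ^ 2) ^ s * ‖u.coeff n‖ ^ 2 := hu
  have h1 := hu'.tsum_eq_zero_add
  push_cast at h1
  have h2 : (0 : ℝ) ≤ ∑' n : ℕ, (1 + ((n : ℝ) + 1) ^ 2) ^ s * ‖u.coeff (n + 1)‖ ^ 2 :=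
    tsum_nonneg fun n => by positivity
  have h3 : (1 + (0 : ℝ) ^ 2) ^ s * ‖u.coeff 0‖ ^ 2 = ‖u.coeff 0‖ ^ 2 := by simp
  rw [h1, normT_sq, h3]
  constructor <;> nlinarith [sq_nonneg ‖u.coeff 0‖]

/-- An operator with a symbol of order `α` is continuous from `T^s` to `T^(s - α)`. -/
lemma ActsBy.normT_le {α : ℝ} {σ : ℝ → ℤ → ℂ} (hσ : σ ∈ symbolClass α)
    {A : TNegInf →L[ℂ] TNegInf} (hA : ActsBy A σ) (s : ℝ) :
    ∃ C : ℝ, ∀ u : TNegInf, u.coeff ∈ coeffSpace s →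
      (A u).coeff ∈ coeffSpace (s - α) ∧ (A u).normT (s - α) ≤ C * u.normT s := by
  obtain ⟨D, hD, h⟩ := hA.tsum_le hσ s
  refine ⟨√(2 * D), fun u hu => ⟨(h u hu).1, ?_⟩⟩
  have h1 := (normT_sq_le_tsum (h u hu).1).1.trans (h u hu).2
  have h2 := h1.trans (mul_le_mul_of_nonneg_left (normT_sq_le_tsum hu).2 hD)
  have h3 : 0 ≤ √(2 * D) * u.normT s := mul_nonneg (Real.sqrt_nonneg _) (Real.sqrt_nonneg _)
  have h4 : 0 ≤ (A u).normT (s - α) := Real.sqrt_nonneg _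
  refine (pow_le_pow_iff_left₀ h4 h3 two_ne_zero).1 ?_
  rw [mul_pow, Real.sq_sqrt (by positivity)]
  linarith

/-! ### Ellipticity -/

section

variable {α : ℝ} {σ : ℝ → ℤ → ℂ}

lemma isRapid_cosTransform {u : TNegInf} (hu : u ∈ TInf chebT) : IsRapid (cosTransform u) := by
  intro L
  have hs : Summable fun n : ℕ => (1 + (n : ℝ) ^ 2) ^ L * ‖u.coeff n‖ ^ 2 := hu L
  set Q := ∑' n : ℕ, (1 + (n : ℝ) ^ 2) ^ L * ‖u.coeff n‖ ^ 2
  refine ⟨√(2 ^ |L| * Q), fun k => (norm_cosTransform_le u k).trans ?_⟩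
  have h1 := hs.le_tsum k.natAbs (fun n _ => by positivity)
  have h2 := (one_add_sq_rpow_le L k.natAbs).2
  have h3 : ((k.natAbs : ℕ) : ℝ) = |(k : ℝ)| := by
    rw [Nat.cast_natAbs, Int.cast_abs]
  have h4 : ((1 + |(k : ℝ)|) ^ L * ‖u.coeff k.natAbs‖) ^ 2 ≤ 2 ^ |L| * Q := by
    rw [mul_pow, ← h3]
    calc _ ≤ 2 ^ |L| * (1 + (k.natAbs : ℝ) ^ 2) ^ L * ‖u.coeff k.natAbs‖ ^ 2 :=
          mul_le_mul_of_nonneg_right h2 (sq_nonneg _)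
      _ = 2 ^ |L| * ((1 + (k.natAbs : ℝ) ^ 2) ^ L * ‖u.coeff k.natAbs‖ ^ 2) := by ring
      _ ≤ _ := mul_le_mul_of_nonneg_left h1 (by positivity)
  have h5 := Real.le_sqrt_of_sq_le h4
  rw [Real.rpow_neg (one_add_abs_pos _).le, ← div_eq_mul_inv,
    le_div_iff₀ (Real.rpow_pos_of_pos (one_add_abs_pos _) _), mul_comm]
  exact h5

lemma Op_cosTransform_basis (σ : ℝ → ℤ → ℂ) (n : ℕ) :
    Op σ (cosTransform (basis chebT n)) = evenAct σ n := by
  funext θ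
  have h1 : ∀ n : ℤ, HasSum (fun m => σ θ m * fourierC (expo n) m * expo m θ)
      (σ θ n * expo n θ) := by
    intro n
    convert hasSum_single n fun m hm => ?_ using 1
    · simp [fourierC_expo]
    · simp [fourierC_expo, hm]
  rw [Op, evenAct, ← (((h1 n).add (h1 (-n))).div_const 2).tsum_eq]
  refine tsum_congr fun m => ?_
  have h2 : cosTransform (basis chebT n) m = (fourierC (expo n) m + fourierC (expo (-n)) m) / 2 := by
    rw [fourierC_expo, fourierC_expo, cosTransform, basis_coeff]
    rcases eq_or_ne m 0 with h | h
    · subst h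
      rcases eq_or_ne n 0 with h' | h'
      · subst h'; simp
      · have h3 : ¬ (0 : ℤ) = n := by omega
        simp [h', Ne.symm h', h3]
    · simp only [h, if_false, Pi.single_apply]
      by_cases h1 : m = n
      · have : ¬ m = -n := by omega
        have h3 : m.natAbs = n := by omega
        simp [h3, this]
        simp [h1]
      · by_cases h2 : m = -n
        · have h3 : m.natAbs = n := by omega
          simp [h3, h1]
          simp [h2]
        · have h3 : ¬ m.natAbs = n := by omega
          simp [h1, h2, h3]
  rw [h2]
  ring

/-- No symmetry of `σ` is assumed: evenness holds because the function has the Fourier coefficients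
of an element of the range of `𝒞`. -/
lemma evenAct_neg {A : TNegInf →L[ℂ] TNegInf} (hσ : σ ∈ symbolClass α) (hA : ActsBy A σ)
    (n : ℕ) (θ : ℝ) : evenAct σ n (-θ) = evenAct σ n θ := by
  have h1 := (isPeriodicSym_evenAct hσ n).hasSum_fourierC (-θ) 0
  have h2 := (isPeriodicSym_evenAct hσ n).hasSum_fourierC θ 0
  rw [← hA n] at h1 h2
  rw [← (Equiv.neg ℤ).hasSum_iff] at h1
  refine h1.unique (h2.congr_fun fun k => ?_)
  simp only [Function.comp_apply, Equiv.neg_apply, cosTransform_neg, expo_neg_right, neg_neg]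

lemma ActsBy.symmetrize {A : TNegInf →L[ℂ] TNegInf} (hσ : σ ∈ symbolClass α) (hA : ActsBy A σ) :
    ActsBy A (symmetrize σ) := by
  intro n
  rw [hA n]
  congr 1
  funext θ
  have h1 := evenAct_neg hσ hA n θ
  simp only [evenAct, ArcPDO.symmetrize, expo_neg_right, neg_neg] at h1 ⊢
  linear_combination (-1 / 2 : ℂ) * h1

/-- The antisymmetric part of the symbol of an operator preserving parity is of lower order. -/
lemma norm_sub_comp_neg_le {A : TNegInf →L[ℂ] TNegInf} (hσ : σ ∈ symbolClass α)
    (hA : ActsBy A σ) :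
    ∃ C : ℝ, 0 ≤ C ∧ ∀ (θ : ℝ) (n : ℤ),
      ‖σ θ n - σ (-θ) (-n)‖ ≤ C * (1 + |(n : ℝ)|) ^ (α - 1) := by
  set d : ℝ → ℤ → ℂ := fun θ n => σ θ n - σ (-θ) (-n) with hd
  have hdc : d ∈ symbolClass α := by
    rw [mem_symbolClass_iff] at hσ ⊢
    obtain ⟨s, hs, es⟩ := hσ
    refine ⟨_, hs.add (hs.comp_neg.const_mul (-1)), fun θ n => ?_⟩
    simp only [hd, es]
    push_cast
    ring
  -- Evenness of the image of `cos(n ·)` ties the value of `d` at frequency `n` to its value at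
  -- `-n`.
  have hnat : ∀ (n : ℕ) (θ : ℝ), d θ n * expo n θ = -(d θ (-n) * expo (-n) θ) := by
    intro n θ
    have h1 := evenAct_neg hσ hA n θ
    simp only [evenAct, expo_neg_right, neg_neg] at h1
    simp only [hd, neg_neg]
    linear_combination (-2 : ℂ) * h1
  have hint : ∀ (n : ℤ) (θ : ℝ), d θ n * expo n θ = -(d θ (-n) * expo (-n) θ) := by
    intro n θ
    obtain ⟨m, rfl | rfl⟩ := n.eq_nat_or_neg
    · exact hnat m θ
    · rw [neg_neg, hnat m θ, neg_neg]
  -- The exponent is `3 = 1 + 2`: one power for the gain in order and two for summability.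
  obtain ⟨C, hC0, hC⟩ := norm_fourierC_mul_expo_le hdc 3
  have hflip : ∀ n m : ℤ, ‖fourierC (fun θ => d θ n * expo n θ) m‖ ≤
      C * (1 + |((m + n : ℤ) : ℝ)|) ^ (-3 : ℝ) * (1 + |(n : ℝ)|) ^ α := by
    intro n m
    have h1 : (fun θ => d θ n * expo n θ) = fun θ => -1 * (d θ (-n) * expo (-n) θ) :=
      funext fun θ => by rw [hint n θ]; ring
    have h2 := hC (-n) m
    rw [sub_neg_eq_add, Int.cast_neg, abs_neg] at h2
    rw [h1, fourierC_const_mul, norm_mul, norm_neg, norm_one, one_mul]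
    exact h2
  set W : ℤ → ℝ := fun k => (1 + |(k : ℝ)|) ^ (-2 : ℝ) with hW
  have hWs : Summable W := summable_one_add_abs_rpow le_rfl
  have hW0 : ∀ k, 0 ≤ W k := fun k => Real.rpow_nonneg (one_add_abs_pos _).le _
  have hgain : ∀ n k : ℤ, |(n : ℝ)| ≤ |(k : ℝ)| →
      (1 + |(k : ℝ)|) ^ (-3 : ℝ) ≤ (1 + |(n : ℝ)|) ^ (-1 : ℝ) * W k := by
    intro n k h
    rw [show (-3 : ℝ) = -1 + -2 by norm_num, Real.rpow_add (one_add_abs_pos _)]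
    refine mul_le_mul_of_nonneg_right ?_ (hW0 k)
    exact Real.rpow_le_rpow_of_nonpos (one_add_abs_pos _) (by linarith) (by norm_num)
  have hcoef : ∀ n m : ℤ, ‖fourierC (fun θ => d θ n * expo n θ) m‖ ≤
      C * (1 + |(n : ℝ)|) ^ (α - 1) * (W (m - n) + W (m + n)) := by
    intro n m
    have hp : (1 + |(n : ℝ)|) ^ (α - 1) = (1 + |(n : ℝ)|) ^ (-1 : ℝ) * (1 + |(n : ℝ)|) ^ α := by
      rw [← Real.rpow_add (one_add_abs_pos _)]
      congr 1
      ring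
    have hα : 0 ≤ (1 + |(n : ℝ)|) ^ α := Real.rpow_nonneg (one_add_abs_pos _).le _
    have h1 : 0 ≤ (1 + |(n : ℝ)|) ^ (-1 : ℝ) := Real.rpow_nonneg (one_add_abs_pos _).le _
    have key : ∀ k k' : ℤ, |(n : ℝ)| ≤ |(k : ℝ)| →
        C * (1 + |(k : ℝ)|) ^ (-3 : ℝ) * (1 + |(n : ℝ)|) ^ α ≤
          C * (1 + |(n : ℝ)|) ^ (α - 1) * (W k + W k') := by
      intro k k' h
      calc _ ≤ C * ((1 + |(n : ℝ)|) ^ (-1 : ℝ) * W k) * (1 + |(n : ℝ)|) ^ α := by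
            gcongr
            exact hgain n k h
        _ ≤ C * ((1 + |(n : ℝ)|) ^ (-1 : ℝ) * (W k + W k')) * (1 + |(n : ℝ)|) ^ α := by
            gcongr
            linarith [hW0 k']
        _ = _ := by rw [hp]; ring
    -- The coefficients of `d(·, n) e_n` decay away from `m = n` and, by the relation above, also
    -- away from `m = -n`. These points are `2|n|` apart, so every `m` is at distance at least `|n|`
    -- from one of them.
    rcases le_total |(n : ℝ)| |((m + n : ℤ) : ℝ)| with h | h
    · rw [add_comm (W _)]
      exact (hflip n m).trans (key _ _ h)
    · refine (hC n m).trans (key _ _ ?_)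
      push_cast at h ⊢
      have h2 := abs_sub ((m : ℝ) + n) ((m : ℝ) - n)
      rw [show (m : ℝ) + n - (m - n) = 2 * n by ring, abs_mul, abs_two] at h2
      linarith
  refine ⟨C * (2 * ∑' k, W k), mul_nonneg hC0 (mul_nonneg two_pos.le (tsum_nonneg hW0)),
    fun θ n => ?_⟩
  have h1 := (isPeriodicSym_mul_expo hdc n).hasSum_fourierC θ 0
  have h2 : HasSum (fun m => W (m - n)) (∑' k, W k) :=
    ((Equiv.subRight n).hasSum_iff (f := W)).2 hWs.hasSum
  have h3 : HasSum (fun m => W (m + n)) (∑' k, W k) :=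
    ((Equiv.addRight n).hasSum_iff (f := W)).2 hWs.hasSum
  have h4 := (h2.add h3).mul_left (C * (1 + |(n : ℝ)|) ^ (α - 1))
  have h5 := tsum_of_norm_bounded h4 (f := fun m => fourierC (fun θ => d θ n * expo n θ) m * expo m θ)
    (fun m => by rw [norm_mul, norm_expo, mul_one]; exact hcoef n m)
  rw [h1.tsum_eq, norm_mul, norm_expo, mul_one] at h5
  refine h5.trans (le_of_eq ?_)
  ring

lemma isEllipticSymbol_symmetrize {A : TNegInf →L[ℂ] TNegInf} (hσ : σ ∈ symbolClass α)
    (hA : ActsBy A σ) (he : IsEllipticSymbol α σ) : IsEllipticSymbol α (symmetrize σ) := by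
  obtain ⟨C, hC0, M, hM⟩ := he
  obtain ⟨D, hD0, hD⟩ := norm_sub_comp_neg_le hσ hA
  -- For `|n| ≥ D / C` the lower-order bound `D (1 + |n|)^(α - 1)` is at most `C (1 + |n|)^α`; half
  -- of it is removed, leaving `C / 2`.
  refine ⟨C / 2, by positivity, max M (D / C), fun θ n hn => ?_⟩
  have h1 := hM θ n ((le_max_left _ _).trans hn)
  have h2 := hD θ n
  have h3 : σ θ n = symmetrize σ θ n + (σ θ n - σ (-θ) (-n)) / 2 := by
    rw [symmetrize]; ring
  have h4 : ‖σ θ n‖ ≤ ‖symmetrize σ θ n‖ + ‖σ θ n - σ (-θ) (-n)‖ / 2 := by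
    have h5 := norm_add_le (symmetrize σ θ n) ((σ θ n - σ (-θ) (-n)) / 2)
    rw [← h3, norm_div, Complex.norm_ofNat] at h5
    exact h5
  have h5 : D ≤ C * (1 + |(n : ℝ)|) := by
    have := (div_le_iff₀ hC0).1 ((le_max_right M (D / C)).trans hn)
    linarith
  have h6 : D * (1 + |(n : ℝ)|) ^ (α - 1) ≤ C * (1 + |(n : ℝ)|) ^ α := by
    have h7 : (1 + |(n : ℝ)|) ^ α = (1 + |(n : ℝ)|) * (1 + |(n : ℝ)|) ^ (α - 1) := by
      rw [Real.rpow_sub_one (one_add_abs_pos _).ne', mul_div_cancel₀ _ (one_add_abs_pos _).ne']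
    rw [h7, ← mul_assoc]
    exact mul_le_mul_of_nonneg_right h5 (Real.rpow_nonneg (one_add_abs_pos _).le _)
  linarith

end

/-! ### Composition and commutators of operators with pairs of symbols -/

lemma IsSymbolPair.comp {α β : ℝ} {A B : TNegInf →L[ℂ] TNegInf} {a₁ a₂ b₁ b₂ : ℝ → ℕ → ℂ}
    (hA : IsSymbolPair α A a₁ a₂) (hB : IsSymbolPair β B b₁ b₂) :
    IsSymbolPair (α + β) (A.comp B)
      (firstSymbol (compSymbol (tildeSymbol a₁ a₂) (tildeSymbol b₁ b₂)))
      (secondSymbol (compSymbol (tildeSymbol a₁ a₂) (tildeSymbol b₁ b₂))) :=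
  (hA.actsBy.comp hA.mem_class hB.mem_class hB.actsBy).isSymbolPair_of_symmetric
    (compSymbol_mem_symbolClass hA.mem_class hB.mem_class)
    ((isSymmetricSymbol_tildeSymbol a₁ a₂).compSymbol (isSymmetricSymbol_tildeSymbol b₁ b₂))

lemma IsSymbolPair.commutator {α β : ℝ} {A B : TNegInf →L[ℂ] TNegInf} {a₁ a₂ b₁ b₂ : ℝ → ℕ → ℂ}
    (hA : IsSymbolPair α A a₁ a₂) (hB : IsSymbolPair β B b₁ b₂) :
    IsSymbolPair (α + β - 1) (A.comp B - B.comp A)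
      (firstSymbol fun θ n => compSymbol (tildeSymbol a₁ a₂) (tildeSymbol b₁ b₂) θ n -
        compSymbol (tildeSymbol b₁ b₂) (tildeSymbol a₁ a₂) θ n)
      (secondSymbol fun θ n => compSymbol (tildeSymbol a₁ a₂) (tildeSymbol b₁ b₂) θ n -
        compSymbol (tildeSymbol b₁ b₂) (tildeSymbol a₁ a₂) θ n) := by
  have hsA := isSymmetricSymbol_tildeSymbol a₁ a₂
  have hsB := isSymmetricSymbol_tildeSymbol b₁ b₂
  refine ActsBy.isSymbolPair_of_symmetric
    (compSymbol_commutator_mem_symbolClass hA.mem_class hB.mem_class) (fun θ n => ?_)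
    (ActsBy.sub (compSymbol_mem_symbolClass hA.mem_class hB.mem_class)
      (compSymbol_mem_symbolClass hB.mem_class hA.mem_class)
      (hA.actsBy.comp hA.mem_class hB.mem_class hB.actsBy)
      (hB.actsBy.comp hB.mem_class hA.mem_class hA.actsBy))
  rw [(hsA.compSymbol hsB) θ n, (hsB.compSymbol hsA) θ n]

end ArcPDO

end

theorem mainTheorem8 (Γ : ArcPDO.SmoothOpenArc) :
    -- (i) continuity on the scale
    (∀ (α : ℝ) (A : Γ.TNegInf →L[ℂ] Γ.TNegInf), A ∈ ArcPDO.OpS Γ α → ∀ s : ℝ,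
      ∃ C : ℝ, ∀ u ∈ ArcPDO.FormalSeries.T Γ.chebT s,
        A u ∈ ArcPDO.FormalSeries.T Γ.chebT (s - α) ∧
          (A u).normT (s - α) ≤ C * u.normT s) ∧
    -- (ii) composition
    (∀ (α β : ℝ) (A B : Γ.TNegInf →L[ℂ] Γ.TNegInf),
      A ∈ ArcPDO.OpS Γ α → B ∈ ArcPDO.OpS Γ β → A.comp B ∈ ArcPDO.OpS Γ (α + β)) ∧
    -- (iii) pair of symbols of a composition
    (∀ (α β : ℝ) (A B : Γ.TNegInf →L[ℂ] Γ.TNegInf) (a₁ a₂ b₁ b₂ : ℝ → ℕ → ℂ),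
      ArcPDO.IsSymbolPairOn Γ α A a₁ a₂ → ArcPDO.IsSymbolPairOn Γ β B b₁ b₂ →
        ArcPDO.IsSymbolPairOn Γ (α + β) (A.comp B)
          (ArcPDO.firstSymbol
            (ArcPDO.compSymbol (ArcPDO.tildeSymbol a₁ a₂) (ArcPDO.tildeSymbol b₁ b₂)))
          (ArcPDO.secondSymbol
            (ArcPDO.compSymbol (ArcPDO.tildeSymbol a₁ a₂) (ArcPDO.tildeSymbol b₁ b₂)))) ∧
    -- (iv) commutators
    (∀ (α β : ℝ) (A B : Γ.TNegInf →L[ℂ] Γ.TNegInf),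
      A ∈ ArcPDO.OpS Γ α → B ∈ ArcPDO.OpS Γ β →
        A.comp B - B.comp A ∈ ArcPDO.OpS Γ (α + β - 1)) ∧
    -- (v) ellipticity
    (∀ (α : ℝ) (A : Γ.TNegInf →L[ℂ] Γ.TNegInf), A ∈ ArcPDO.OpS Γ α →
      (ArcPDO.IsEllipticOn Γ α A ↔
        ∃ σ ∈ ArcPDO.symbolClass α, ArcPDO.IsEllipticSymbol α σ ∧
          ∀ u ∈ ArcPDO.FormalSeries.TInf ArcPDO.chebT,
            ArcPDO.cosTransform (Γ.conj A u) =
              ArcPDO.fourierC (ArcPDO.Op σ (ArcPDO.cosTransform u)))) := by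
  refine ⟨fun α A hA s => ?_, fun α β A B hA hB => ?_, fun α β A B a₁ a₂ b₁ b₂ hA hB => ?_,
    fun α β A B hA hB => ?_, fun α A hA => ⟨?_, ?_⟩⟩
  · obtain ⟨a₁, a₂, h⟩ := hA
    obtain ⟨C, hC⟩ := h.actsBy.normT_le h.mem_class s
    -- `Γ.R` keeps the coefficients, hence the spaces and norms, so the estimate on `[-1, 1]` is the
    -- one on `Γ`.
    exact ⟨C, fun u hu => hC (Γ.R u) hu⟩
  · obtain ⟨a₁, a₂, hA⟩ := hA
    obtain ⟨b₁, b₂, hB⟩ := hB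
    exact ⟨_, _, hA.comp hB⟩
  · exact hA.comp hB
  · obtain ⟨a₁, a₂, hA⟩ := hA
    obtain ⟨b₁, b₂, hB⟩ := hB
    exact ⟨_, _, hA.commutator hB⟩
  · rintro ⟨a₁, a₂, h, he⟩
    exact ⟨_, h.mem_class, he, fun u hu =>
      h.actsBy.cosTransform_apply h.mem_class (ArcPDO.isRapid_cosTransform hu)⟩
  · rintro ⟨σ, hσ, he, h⟩
    -- The `T_n` are in `T^∞`, so the intertwining relation already gives the action on cosines; the
    -- symbol is then symmetrized to obtain an elliptic pair.
    have hact : ArcPDO.ActsBy (Γ.conj A) σ := fun n => by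
      rw [h _ (ArcPDO.FormalSeries.basis_mem_TInf n), ArcPDO.Op_cosTransform_basis]
    have hsc := ArcPDO.symmetrize_mem_symbolClass hσ
    have hss := ArcPDO.isSymmetricSymbol_symmetrize σ
    refine ⟨_, _, (hact.symmetrize hσ).isSymbolPair_of_symmetric hsc hss, ?_⟩
    rw [ArcPDO.tildeSymbol_firstSymbol_secondSymbol hsc hss]
    exact ArcPDO.isEllipticSymbol_symmetrize hσ hact he
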